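/- Let $n\ge 2$. Write $B(x,r)$ for open balls of $\mathbb R^n$, $|\cdot|$ for the Euclidean norm and for Lebesgue (outer) measure, $\omega_n:=|B(0,1)|$, and $\|A\|:=\max_{|v|=1}|Av|$ for $A\in\mathbb R^{n\times n}$. The $1$-capacity of $A\subset\mathbb R^n$ is $\operatorname{cap}_1(A):=\inf\big(\|u\|_{L^1(\mathbb R^n)}+\|\nabla u\|_{L^1(\mathbb R^n)}\big)$, where the infimum is over all $u\in W^{1,1}(\mathbb R^n)$ with $u\ge 1$ in a neighborhood of $A$. A set $U\subset\mathbb R^n$ is called $1$-finely open if for every $x\in U$ $$\lim_{r\to 0}\frac{\operatorname{cap}_1(B(x,r)\setminus U)}{r^{n-1}}=0 .$$ Let $\Omega,\Omega'\subset\mathbb R^n$ be open and let $f\in W^{1,1}_{\mathrm{loc}}(\Omega;\Omega')$ be a homeomorphism of $\Omega$ onto $\Omega'$, with weak gradient $\nabla f$. For $x\in\Omega$, $U\subset\mathbb R^n$ and $r>0$ small enough that $B(x,r)\subset\Omega$, let $$K_{f,U}(x,r):=\left(\frac{\operatorname{diam} f(B(x,r)\cap U)^n}{|f(B(x,r))|}\right)^{1/(n-1)},$$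 and define $$K_f(x):=\limsup_{r\to0}K_{f,\mathbb R^n}(x,r),\qquad K_f^{\mathrm{fine}}(x):=\inf_{U}\,\limsup_{r\to0}K_{f,U}(x,r),\qquad J_f(x):=\limsup_{r\to0}\frac{|f(B(x,r))|}{|B(x,r)|},$$ where the infimum is over all $1$-finely open sets $U$ with $x\in U$. Then $$K_f^{\mathrm{fine}}(x)^{n-1}J_f(x)=\frac{2^n}{\omega_n}\,\|\nabla f(x)\|^n\qquad\text{for a.e. }x\in\Omega\text{ for which }K_f^{\mathrm{fine}}(x)<\infty,$$ and $K_f(x)=K_f^{\mathrm{fine}}(x)$ for a.e. $x\in\Omega$ at which $f$ is differentiable and $0<J_f(x)<\infty$. -/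

import Mathlib

open MeasureTheory Filter Topology Set
open scoped ENNReal ContDiff

namespace FineQC

noncomputable section

/-- Euclidean space `ℝⁿ`, with the Euclidean norm and Lebesgue measure. -/
abbrev Rn (n : ℕ) : Type := EuclideanSpace ℝ (Fin n)

/-- `G` is a weak gradient of `f` on the open set `Ω`: the two maps are locally integrable on `Ω`,
and the integration-by-parts formula holds in every direction against all test functions in
`C_c^∞(Ω)`. At each point `G x` is a linear map, with its operator norm `max_{|v| = 1} |G x v|`;
for `F = ℝ` this is the Euclidean norm of the gradient vector. -/
structure IsWeakGradient {n : ℕ} {F : Type*} [NormedAddCommGroup F] [NormedSpace ℝ F]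
    (Ω : Set (Rn n)) (f : Rn n → F) (G : Rn n → Rn n →L[ℝ] F) : Prop where
  locallyIntegrableOn : LocallyIntegrableOn f Ω volume
  locallyIntegrableOn_grad : LocallyIntegrableOn G Ω volume
  integral_eq : ∀ φ : Rn n → ℝ, ContDiff ℝ ∞ φ → HasCompactSupport φ → tsupport φ ⊆ Ω →
    ∀ v : Rn n, ∫ x in Ω, (fderiv ℝ φ x v) • f x = - ∫ x in Ω, φ x • G x v

/-- `f ∈ W^{1,1}_loc(Ω; F)`. -/
def MemW11Loc {n : ℕ} {F : Type*} [NormedAddCommGroup F] [NormedSpace ℝ F]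
    (Ω : Set (Rn n)) (f : Rn n → F) : Prop :=
  ∃ G : Rn n → Rn n →L[ℝ] F, IsWeakGradient Ω f G

/-- `f` restricts to a homeomorphism of `Ω` onto `Ω'`. Only the values of `f` in `Ω` matter. -/
def IsHomeoOn {n : ℕ} (f : Rn n → Rn n) (Ω Ω' : Set (Rn n)) : Prop :=
  ∃ e : Ω ≃ₜ Ω', ∀ x : Ω, (e x : Rn n) = f x

/-- The Sobolev `1`-capacity: the infimum of `‖u‖_{L¹} + ‖∇u‖_{L¹}` over all `u ∈ W^{1,1}(ℝⁿ)`
with `u ≥ 1` (almost everywhere) in a neighborhood of `A`. -/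
def capOne {n : ℕ} (A : Set (Rn n)) : ℝ≥0∞ :=
  ⨅ (u : Rn n → ℝ) (g : Rn n → Rn n →L[ℝ] ℝ) (_ : Integrable u volume) (_ : Integrable g volume)
    (_ : IsWeakGradient univ u g)
    (_ : ∃ W : Set (Rn n), IsOpen W ∧ A ⊆ W ∧ ∀ᵐ x ∂(volume.restrict W), 1 ≤ u x),
    (∫⁻ x, ‖u x‖ₑ) + ∫⁻ x, ‖g x‖ₑ

/-- `A` is `1`-thin at `x`. -/
def IsThinAt {n : ℕ} (A : Set (Rn n)) (x : Rn n) : Prop :=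
  Tendsto (fun r : ℝ => capOne (A ∩ Metric.ball x r) / ENNReal.ofReal r ^ (n - 1))
    (𝓝[>] 0) (𝓝 0)

/-- `U` is `1`-finely open: its complement is `1`-thin at every point of `U`. -/
def IsFinelyOpen {n : ℕ} (U : Set (Rn n)) : Prop :=
  ∀ x ∈ U, IsThinAt Uᶜ x

open Classical in
/-- `K_{f,U}(x,r) = (diam f(B(x,r) ∩ U)^n / |f(B(x,r))|)^{1/(n-1)}`, with value `∞` if
`|f(B(x,r))| = 0`. -/
def distortion {n : ℕ} (f : Rn n → Rn n) (U : Set (Rn n)) (x : Rn n) (r : ℝ) : ℝ≥0∞ :=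
  if volume (f '' Metric.ball x r) = 0 then ⊤
  else (Metric.ediam (f '' (Metric.ball x r ∩ U)) ^ n / volume (f '' Metric.ball x r))
    ^ (1 / ((n : ℝ) - 1))

/-- The metric distortion `K_f(x)`. -/
def K {n : ℕ} (f : Rn n → Rn n) (x : Rn n) : ℝ≥0∞ :=
  limsup (fun r : ℝ => distortion f univ x r) (𝓝[>] 0)

/-- The relaxed distortion `K_f^fine(x)`: the infimum over `1`-finely open sets `U ∋ x`. -/
def KFine {n : ℕ} (f : Rn n → Rn n) (x : Rn n) : ℝ≥0∞ :=
  ⨅ (U : Set (Rn n)) (_ : IsFinelyOpen U) (_ : x ∈ U),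
    limsup (fun r : ℝ => distortion f U x r) (𝓝[>] 0)

/-- The Jacobian `J_f(x)`: the upper volume derivative of `f` at `x`. -/
def jacobian {n : ℕ} (f : Rn n → Rn n) (x : Rn n) : ℝ≥0∞ :=
  limsup (fun r : ℝ => volume (f '' Metric.ball x r) / volume (Metric.ball x r)) (𝓝[>] 0)

/-- `ω_n`, the Lebesgue measure of the unit ball of `ℝⁿ`. -/
def unitBallVolume (n : ℕ) : ℝ≥0∞ := volume (Metric.ball (0 : Rn n) 1)

end

end FineQC

/-!
The distortion of `f` is compared with that of its linearisations, both from above and from below,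
along fine neighbourhoods.

*Fine differentiability.* Let `x` be a Lebesgue point of the weak gradient `G` and put `A = G x`.
For every `ε > 0` the set where `f` deviates from `y ↦ f x + A (y - x)` by at least `ε ‖y - x‖` is
`1`-thin at `x` (`isThinAt_deviationSet`). The test functions for the capacity are built scale by
scale: the deviation is approximated uniformly on a ball by the deviation `h` of a mollification, a
smooth substitute for `‖h‖` is rescaled and cut off, and its `W^{1,1}` norm is controlled by the
averages of `‖G - A‖` around `x`; for `‖h‖` itself this uses integration along the segments issuing
from `x` (`setLIntegral_enorm_le_of_fderiv`). The dyadic scales are then summed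
(`capOne_deviation_le`). Since `f` is continuous, a ball minus the deviation set is finely open
(`isFinelyOpen_ball_diff_deviationSet`), so it competes in the infimum that defines the fine
distortion, and its image has diameter at most `2 (‖A‖ + ε) r` in `B(x, r)`.

*Thin sets are small.* By the Gagliardo–Nirenberg–Sobolev inequality a thin set has Lebesgue
density zero (`IsThinAt.hasDensityZeroAt`). Hence every finely open set containing `x`
has points near both ends of a diameter of `B(x, r)` in a direction in which `A` almost attains its
norm, and the deviation at these points can be taken small. So the image diameter is at least
`(2 ‖A‖ - 8 ε) r` (`eventually_le_ediam_image`).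

*Volume derivative.* The volume of images under a homeomorphism is a locally finite measure, so the
upper limit defining the Jacobian is a finite limit `L` almost everywhere
(`IsHomeoOn.ae_tendsto_volume_ratio`). If `L > 0`, letting `ε → 0` gives the fine distortion
exactly. If `L = 0` and `A ≠ 0`, the lower bound makes the fine distortion infinite. At a point of
differentiability the deviation sets are empty near `x`, so the upper bound already holds for the
full balls and the two distortions agree.
-/

namespace FineQC

/-! ### Test functions for the capacity -/

/-- The classical derivative of a compactly supported `C¹` function is a weak gradient. -/
theorem isWeakGradient_fderiv {n : ℕ} {u : Rn n → ℝ} (hu : ContDiff ℝ 1 u)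
    (hc : HasCompactSupport u) : IsWeakGradient univ u (fderiv ℝ u) where
  locallyIntegrableOn := hu.continuous.locallyIntegrable.locallyIntegrableOn _
  locallyIntegrableOn_grad :=
    (hu.continuous_fderiv one_ne_zero).locallyIntegrable.locallyIntegrableOn _
  integral_eq := by
    intro φ hφ hφc _ v
    have hφ1 : ContDiff ℝ 1 φ := hφ.of_le (by simp)
    have hdu := hu.continuous_fderiv one_ne_zero
    have hdφ := hφ1.continuous_fderiv one_ne_zero
    simp only [Measure.restrict_univ]
    rw [integral_smul_fderiv_eq_neg_fderiv_smul_of_integrable, neg_neg]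
    · exact ((hdφ.clm_apply continuous_const).smul hu.continuous).integrable_of_hasCompactSupport
        (HasCompactSupport.smul_left hc)
    · exact (hφ.continuous.smul (hdu.clm_apply continuous_const)).integrable_of_hasCompactSupport
        (HasCompactSupport.smul_right hφc)
    · exact (hφ.continuous.smul hu.continuous).integrable_of_hasCompactSupport
        (HasCompactSupport.smul_left hc)
    · exact fun x _ => (hφ1.differentiable one_ne_zero) x
    · exact fun x _ => (hu.differentiable one_ne_zero) x

/-- Termwise integrable functions with summable `L¹` norms have an integrable sum, and the sum
converges absolutely almost everywhere. -/
theorem integrable_tsum_of_lintegral {α E : Type*} [MeasurableSpace α] {μ : Measure α}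
    [NormedAddCommGroup E] [CompleteSpace E] {u : ℕ → α → E} (hu : ∀ k, Integrable (u k) μ)
    (hs : ∑' k, ∫⁻ x, ‖u k x‖ₑ ∂μ ≠ ⊤) :
    Integrable (fun x => ∑' k, u k x) μ ∧ (∀ᵐ x ∂μ, Summable fun k => u k x) ∧
      ∫⁻ x, ‖∑' k, u k x‖ₑ ∂μ ≤ ∑' k, ∫⁻ x, ‖u k x‖ₑ ∂μ := by
  have hm : ∀ k, AEMeasurable (fun x => ‖u k x‖ₑ) μ := fun k => (hu k).1.enorm
  have hle : ∫⁻ x, ‖∑' k, u k x‖ₑ ∂μ ≤ ∑' k, ∫⁻ x, ‖u k x‖ₑ ∂μ := by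
    rw [← lintegral_tsum hm]
    exact lintegral_mono fun x => enorm_tsum_le_tsum_enorm
  have hsum : ∀ᵐ x ∂μ, Summable fun k => u k x := by
    have h1 := hs
    rw [← lintegral_tsum hm] at h1
    filter_upwards [ae_lt_top' (AEMeasurable.tsum hm) h1] with x hx
    exact (tsum_enorm_ne_top_iff_summable_norm.1 hx.ne).of_norm
  refine ⟨⟨?_, hle.trans_lt hs.lt_top⟩, hsum, hle⟩
  refine aestronglyMeasurable_of_tendsto_ae atTop
    (f := fun N x => ∑ k ∈ Finset.range N, u k x) (fun N => ?_) ?_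
  · exact Finset.aestronglyMeasurable_fun_sum _ fun k _ => (hu k).1
  · filter_upwards [hsum] with x hx using hx.hasSum.tendsto_sum_nat

/-- A countable sum of functions with weak gradients on `ℝⁿ` has the sum of the gradients as weak
gradient, provided that the `W^{1,1}` norms are summable. -/
theorem isWeakGradient_tsum {n : ℕ} {u : ℕ → Rn n → ℝ} {g : ℕ → Rn n → Rn n →L[ℝ] ℝ}
    (hu : ∀ k, Integrable (u k)) (hg : ∀ k, Integrable (g k))
    (hw : ∀ k, IsWeakGradient univ (u k) (g k))
    (hus : ∑' k, ∫⁻ x, ‖u k x‖ₑ ≠ ⊤) (hgs : ∑' k, ∫⁻ x, ‖g k x‖ₑ ≠ ⊤) :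
    IsWeakGradient univ (fun x => ∑' k, u k x) (fun x => ∑' k, g k x) := by
  obtain ⟨hui, husum, -⟩ := integrable_tsum_of_lintegral hu hus
  obtain ⟨hgi, hgsum, -⟩ := integrable_tsum_of_lintegral hg hgs
  refine ⟨hui.locallyIntegrable.locallyIntegrableOn _,
    hgi.locallyIntegrable.locallyIntegrableOn _, fun φ hφ hφc hφs v => ?_⟩
  have hdφ : Continuous fun x => fderiv ℝ φ x v :=
    ((hφ.of_le (by simp)).continuous_fderiv one_ne_zero).clm_apply continuous_const
  -- multiplication by a bounded factor preserves summability of the `L¹` norms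
  have key : ∀ (F : ℕ → Rn n → ℝ) (w : ℕ → Rn n → ℝ≥0∞) (C : ℝ≥0∞), C ≠ ⊤ →
      ∑' k, ∫⁻ x, w k x ≠ ⊤ → (∀ k x, ‖F k x‖ₑ ≤ C * w k x) → ∑' k, ∫⁻ x, ‖F k x‖ₑ ≠ ⊤ := by
    intro F w C hC hw hF
    refine ne_top_of_le_ne_top (ENNReal.mul_ne_top hC hw) ?_
    rw [← ENNReal.tsum_mul_left]
    refine ENNReal.tsum_le_tsum fun k => ?_
    rw [← lintegral_const_mul' _ _ hC]
    exact lintegral_mono (hF k)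
  obtain ⟨C₁, hC₁⟩ := (hφc.fderiv_apply (𝕜 := ℝ) v).exists_bound_of_continuous hdφ
  obtain ⟨C₂, hC₂⟩ := hφc.exists_bound_of_continuous hφ.continuous
  simp only [Measure.restrict_univ]
  have e1 : ∫ x, fderiv ℝ φ x v • ∑' k, u k x = ∑' k, ∫ x, fderiv ℝ φ x v • u k x := by
    rw [← integral_tsum]
    · simp_rw [smul_eq_mul, tsum_mul_left]
    · exact fun k => hdφ.aestronglyMeasurable.smul (hu k).1
    · refine key _ (fun k x => ‖u k x‖ₑ) (ENNReal.ofReal C₁) ENNReal.ofReal_ne_top hus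
        fun k x => ?_
      rw [enorm_smul]
      gcongr
      rw [← ofReal_norm]
      exact ENNReal.ofReal_le_ofReal (hC₁ x)
  have e2 : ∫ x, φ x • (∑' k, g k x) v = ∑' k, ∫ x, φ x • g k x v := by
    rw [← integral_tsum]
    · refine integral_congr_ae ?_
      filter_upwards [hgsum] with x hx
      have : (∑' k, g k x) v = ∑' k, g k x v :=
        (ContinuousLinearMap.apply ℝ ℝ v).map_tsum hx
      rw [this, smul_eq_mul, ← tsum_mul_left]
      rfl
    · exact fun k => hφ.continuous.aestronglyMeasurable.smul
        ((ContinuousLinearMap.apply ℝ ℝ v).continuous.comp_aestronglyMeasurable (hg k).1)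
    · refine key _ (fun k x => ‖g k x‖ₑ) (ENNReal.ofReal C₂ * ‖v‖ₑ)
        (ENNReal.mul_ne_top ENNReal.ofReal_ne_top enorm_ne_top) hgs fun k x => ?_
      rw [enorm_smul, mul_assoc, mul_comm ‖v‖ₑ]
      gcongr
      · rw [← ofReal_norm]
        exact ENNReal.ofReal_le_ofReal (hC₂ x)
      · exact (g k x).le_opENorm v
  rw [e1, e2, ← tsum_neg]
  refine tsum_congr fun k => ?_
  simpa using (hw k).integral_eq φ hφ hφc hφs v

theorem capOne_le {n : ℕ} {A W : Set (Rn n)} {u : Rn n → ℝ} {g : Rn n → Rn n →L[ℝ] ℝ}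
    (hu : Integrable u) (hg : Integrable g) (hw : IsWeakGradient univ u g) (hW : IsOpen W)
    (hAW : A ⊆ W) (h1 : ∀ᵐ x ∂(volume.restrict W), 1 ≤ u x) :
    capOne A ≤ (∫⁻ x, ‖u x‖ₑ) + ∫⁻ x, ‖g x‖ₑ :=
  iInf_le_of_le u <| iInf_le_of_le g <| iInf_le_of_le hu <| iInf_le_of_le hg <|
    iInf_le_of_le hw <| iInf_le_of_le ⟨W, hW, hAW, h1⟩ le_rfl

/-- Countable subadditivity of the capacity on the level of test functions. -/
theorem capOne_le_tsum {n : ℕ} {A : Set (Rn n)} (u : ℕ → Rn n → ℝ)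
    (hu : ∀ k, ContDiff ℝ 1 (u k)) (hc : ∀ k, HasCompactSupport (u k)) (h0 : ∀ k x, 0 ≤ u k x)
    (hA : A ⊆ ⋃ k, {x | 1 < u k x}) :
    capOne A ≤ ∑' k, ((∫⁻ x, ‖u k x‖ₑ) + ∫⁻ x, ‖fderiv ℝ (u k) x‖ₑ) := by
  rw [ENNReal.tsum_add]
  by_cases hus : ∑' k, ∫⁻ x, ‖u k x‖ₑ = ⊤
  · simp [hus]
  by_cases hgs : ∑' k, ∫⁻ x, ‖fderiv ℝ (u k) x‖ₑ = ⊤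
  · simp [hgs]
  have hui : ∀ k, Integrable (u k) := fun k =>
    (hu k).continuous.integrable_of_hasCompactSupport (hc k)
  have hgi : ∀ k, Integrable (fderiv ℝ (u k)) := fun k =>
    ((hu k).continuous_fderiv one_ne_zero).integrable_of_hasCompactSupport ((hc k).fderiv (𝕜 := ℝ))
  obtain ⟨h1, h2, h3⟩ := integrable_tsum_of_lintegral hui hus
  obtain ⟨h4, -, h5⟩ := integrable_tsum_of_lintegral hgi hgs
  refine (capOne_le h1 h4 (isWeakGradient_tsum hui hgi
      (fun k => isWeakGradient_fderiv (hu k) (hc k)) hus hgs)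
    (isOpen_iUnion fun k => isOpen_lt continuous_const (hu k).continuous) hA ?_).trans
      (add_le_add h3 h5)
  rw [ae_restrict_iff' (MeasurableSet.iUnion fun k =>
    measurableSet_lt measurable_const (hu k).continuous.measurable)]
  filter_upwards [h2] with x hx hxW
  obtain ⟨k, hk⟩ := mem_iUnion.1 hxW
  exact hk.le.trans (hx.le_tsum k fun j _ => h0 j x)

theorem capOne_empty {n : ℕ} : capOne (∅ : Set (Rn n)) = 0 := by
  have := capOne_le_tsum (A := (∅ : Set (Rn n))) (fun _ _ => 0) (fun _ => contDiff_const)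
    (fun _ => HasCompactSupport.zero) (fun _ _ => le_rfl) (empty_subset _)
  have h0 : fderiv ℝ (fun _ : Rn n => (0 : ℝ)) = fun _ => 0 := by
    ext x v
    simp
  simpa only [h0, ← ofReal_norm, norm_zero, ENNReal.ofReal_zero, lintegral_zero, add_zero,
    tsum_zero, nonpos_iff_eq_zero] using this

theorem capOne_mono {n : ℕ} {A B : Set (Rn n)} (h : A ⊆ B) : capOne A ≤ capOne B := by
  unfold capOne
  gcongr with u g hu hg hw
  refine le_iInf fun hW => iInf_le_of_le ?_ le_rfl
  obtain ⟨W, hW, hBW, h1⟩ := hW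
  exact ⟨W, hW, h.trans hBW, h1⟩

/-! ### Mollification of Sobolev functions -/

section Mollify

variable {n : ℕ} {F : Type*} [NormedAddCommGroup F] [NormedSpace ℝ F] [CompleteSpace F]

/-- The mollification of `g` by the normalised bump function `φ`. -/
noncomputable def mollify (φ : ContDiffBump (0 : Rn n)) (g : Rn n → F) : Rn n → F :=
  convolution (φ.normed volume) g (ContinuousLinearMap.lsmul ℝ ℝ) volume

omit [CompleteSpace F] in
theorem contDiff_mollify (φ : ContDiffBump (0 : Rn n)) {g : Rn n → F}
    (hg : LocallyIntegrable g) : ContDiff ℝ 1 (mollify φ g) :=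
  φ.hasCompactSupport_normed.contDiff_convolution_left _ (φ.contDiff_normed (n := 1)) hg

omit [NormedSpace ℝ F] [CompleteSpace F] in
theorem locallyIntegrable_indicator {S : Set (Rn n)} {g : Rn n → F} (hg : IntegrableOn g S)
    (hS : MeasurableSet S) : LocallyIntegrable (S.indicator g) :=
  (hg.integrable_indicator hS).locallyIntegrable

omit [CompleteSpace F] in
/-- Mollification commutes with weak differentiation at points whose `φ.rOut`-neighbourhood is not
affected by the truncation to `S`. -/
theorem fderiv_mollify (φ : ContDiffBump (0 : Rn n)) {Ω S : Set (Rn n)} {f : Rn n → F}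
    {G : Rn n → Rn n →L[ℝ] F} (hG : IsWeakGradient Ω f G) (hS : MeasurableSet S) (hSΩ : S ⊆ Ω)
    (hfS : IntegrableOn f S) (hGS : IntegrableOn G S) {y : Rn n}
    (hy : Metric.closedBall y φ.rOut ⊆ S) :
    fderiv ℝ (mollify φ (S.indicator f)) y = mollify φ (S.indicator G) y := by
  have hfi : LocallyIntegrable (S.indicator f) := locallyIntegrable_indicator hfS hS
  have hGi : LocallyIntegrable (S.indicator G) := locallyIntegrable_indicator hGS hS
  have hφ1 : ContDiff ℝ ∞ (φ.normed volume) := φ.contDiff_normed (n := ⊤)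
  have hφc := φ.hasCompactSupport_normed (μ := volume)
  have h1 := (hφc.hasFDerivAt_convolution_left (ContinuousLinearMap.lsmul ℝ ℝ)
    (hφ1.of_le (by simp)) hfi y).fderiv
  unfold mollify
  rw [h1]
  ext1 v
  have hL : ConvolutionExistsAt (fderiv ℝ (φ.normed volume)) (S.indicator f) y
      ((ContinuousLinearMap.lsmul ℝ ℝ).precompL (Rn n)) volume :=
    (hφc.fderiv (𝕜 := ℝ)).convolutionExists_left _
      ((hφ1.of_le (by simp)).continuous_fderiv one_ne_zero) hfi y
  have hR : ConvolutionExistsAt (φ.normed volume) (S.indicator G) y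
      (ContinuousLinearMap.lsmul ℝ ℝ) volume :=
    hφc.convolutionExists_left _ hφ1.continuous hGi y
  rw [convolution_def, convolution_def, ContinuousLinearMap.integral_apply hL,
    ContinuousLinearMap.integral_apply hR]
  simp only [ContinuousLinearMap.precompL_apply, ContinuousLinearMap.lsmul_apply,
    _root_.smul_apply]
  rw [← integral_sub_left_eq_self _ volume y,
    ← integral_sub_left_eq_self (fun t => φ.normed volume t • (S.indicator G (y - t)) v) volume y]
  simp only [sub_sub_cancel]
  -- the test function is `z ↦ φ (y - z)`
  set ψ : Rn n → ℝ := fun z => φ.normed volume (y - z) with hψ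
  have hψs : ContDiff ℝ ∞ ψ := hφ1.comp (contDiff_const.sub contDiff_id)
  have hψ0 : ∀ z, z ∉ Metric.closedBall y φ.rOut → ψ z = 0 := by
    intro z hz
    have : y - z ∉ Function.support (φ.normed (volume : Measure (Rn n))) := by
      rw [φ.support_normed_eq, mem_ball_zero_iff, ← dist_eq_norm, dist_comm]
      exact fun h => hz (Metric.ball_subset_closedBall h)
    simpa using this
  have hts : tsupport ψ ⊆ Metric.closedBall y φ.rOut :=
    closure_minimal (fun z hz => by_contra fun h => hz (hψ0 z h)) Metric.isClosed_closedBall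
  have hψc : HasCompactSupport ψ :=
    HasCompactSupport.of_support_subset_isCompact (isCompact_closedBall y φ.rOut)
      ((subset_tsupport _).trans hts)
  have hdψ : ∀ z, fderiv ℝ ψ z v = -(fderiv ℝ (φ.normed volume) (y - z) v) := by
    intro z
    have h2 : HasFDerivAt ψ ((fderiv ℝ (φ.normed volume) (y - z)).comp
        (-(ContinuousLinearMap.id ℝ (Rn n)))) z :=
      ((hφ1.differentiable (by simp)) (y - z)).hasFDerivAt.comp z
        ((hasFDerivAt_id z).const_sub y)
    rw [h2.fderiv]
    simp
  have h3 := hG.integral_eq ψ hψs hψc (hts.trans (hy.trans hSΩ)) v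
  have hz1 : ∀ z, z ∉ S → fderiv ℝ ψ z v = 0 := fun z hz => by
    have : z ∉ tsupport (fderiv ℝ ψ) := fun h => hz (hy (hts (tsupport_fderiv_subset ℝ h)))
    rw [image_eq_zero_of_notMem_tsupport this]
    rfl
  have hz2 : ∀ z, z ∉ S → ψ z = 0 := fun z hz => hψ0 z fun h => hz (hy h)
  rw [setIntegral_eq_integral_of_forall_compl_eq_zero
      (fun z hz => by rw [hz1 z fun h => hz (hSΩ h), zero_smul]),
    setIntegral_eq_integral_of_forall_compl_eq_zero
      (fun z hz => by rw [hz2 z fun h => hz (hSΩ h), zero_smul])] at h3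
  calc ∫ z, fderiv ℝ (φ.normed volume) (y - z) v • S.indicator f z
      = ∫ z, -(fderiv ℝ ψ z v • f z) := by
        refine integral_congr_ae (.of_forall fun z => ?_)
        by_cases hz : z ∈ S
        · simp [hz, hdψ]
        · simp [hz, hz1]
    _ = ∫ z, ψ z • G z v := by rw [integral_neg, h3, neg_neg]
    _ = _ := by
        refine integral_congr_ae (.of_forall fun z => ?_)
        by_cases hz : z ∈ S
        · simp [hz, hψ]
        · have := hz2 z hz
          simp only [hψ] at this
          simp [hz, this, hψ]

theorem enorm_mollify_sub_le (φ : ContDiffBump (0 : Rn n)) {g : Rn n → F}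
    (hg : LocallyIntegrable g) (a : F) (y : Rn n) :
    ‖mollify φ g y - a‖ₑ ≤ ∫⁻ z, ENNReal.ofReal (φ.normed volume z) * ‖g (y - z) - a‖ₑ := by
  have hR : Integrable fun t => φ.normed volume t • g (y - t) :=
    φ.hasCompactSupport_normed.convolutionExists_left (ContinuousLinearMap.lsmul ℝ ℝ)
      φ.continuous_normed hg y
  have : mollify φ g y - a = ∫ z, φ.normed volume z • (g (y - z) - a) := by
    simp_rw [smul_sub]
    rw [integral_sub hR (φ.integrable_normed.smul_const a), φ.integral_normed_smul]
    rfl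
  rw [this]
  refine (enorm_integral_le_lintegral_enorm _).trans (lintegral_mono fun z => ?_)
  rw [enorm_smul, ← ofReal_norm (φ.normed volume z), Real.norm_of_nonneg (φ.nonneg_normed z)]

theorem normed_eq_zero (φ : ContDiffBump (0 : Rn n)) {z : Rn n} (hz : φ.rOut ≤ ‖z‖) :
    φ.normed volume z = 0 := by
  have : z ∉ Function.support (φ.normed (volume : Measure (Rn n))) := by
    rw [φ.support_normed_eq, mem_ball_zero_iff]
    exact hz.not_gt
  simpa using this

/-- Mollification does not increase the `L¹` distance to a constant, up to enlarging the ball by the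
mollification radius. -/
theorem setLIntegral_mollify_sub_le (φ : ContDiffBump (0 : Rn n)) {g : Rn n → F}
    (hg : LocallyIntegrable g) (a : F) (x : Rn n) (τ : ℝ) :
    ∫⁻ y in Metric.ball x τ, ‖mollify φ g y - a‖ₑ ≤
      ∫⁻ y in Metric.ball x (τ + φ.rOut), ‖g y - a‖ₑ := by
  have hgm : AEMeasurable (fun p : Rn n × Rn n => ‖g (p.1 - p.2) - a‖ₑ)
      ((volume.restrict (Metric.ball x τ)).prod volume) := by
    have : AEMeasurable (fun y => ‖g y - a‖ₑ) volume :=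
      (hg.aestronglyMeasurable.sub aestronglyMeasurable_const).enorm
    exact (this.comp_quasiMeasurePreserving (quasiMeasurePreserving_sub volume volume)).mono_measure
      (Measure.prod_mono Measure.restrict_le_self le_rfl)
  have hφm : Measurable fun z => ENNReal.ofReal (φ.normed volume z) :=
    φ.continuous_normed.measurable.ennreal_ofReal
  calc ∫⁻ y in Metric.ball x τ, ‖mollify φ g y - a‖ₑ
      ≤ ∫⁻ y in Metric.ball x τ, ∫⁻ z, ENNReal.ofReal (φ.normed volume z) * ‖g (y - z) - a‖ₑ :=
        lintegral_mono fun y => enorm_mollify_sub_le φ hg a y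
    _ = ∫⁻ z, ∫⁻ y in Metric.ball x τ, ENNReal.ofReal (φ.normed volume z) * ‖g (y - z) - a‖ₑ :=
        lintegral_lintegral_swap ((hφm.comp measurable_snd).aemeasurable.mul hgm)
    _ ≤ ∫⁻ z, ENNReal.ofReal (φ.normed volume z) *
          ∫⁻ y in Metric.ball x (τ + φ.rOut), ‖g y - a‖ₑ := by
        refine lintegral_mono fun z => ?_
        rw [lintegral_const_mul' _ _ ENNReal.ofReal_ne_top]
        rcases le_or_gt φ.rOut ‖z‖ with hz | hz
        · simp [normed_eq_zero φ hz]
        refine mul_le_mul_right ?_ _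
        rw [← lintegral_indicator Metric.isOpen_ball.measurableSet,
          ← lintegral_add_right_eq_self _ z, ← lintegral_indicator Metric.isOpen_ball.measurableSet]
        refine lintegral_mono fun y => ?_
        by_cases hy : y + z ∈ Metric.ball x τ
        · have : y ∈ Metric.ball x (τ + φ.rOut) := by
            rw [mem_ball_iff_norm] at hy ⊢
            calc ‖y - x‖ = ‖(y + z - x) - z‖ := by congr 1; abel
              _ ≤ ‖y + z - x‖ + ‖z‖ := norm_sub_le _ _
              _ < _ := by linarith
          simp [hy, this]
        · simp [hy]
    _ = _ := by
        rw [lintegral_mul_const _ hφm, ← ofReal_integral_eq_lintegral_ofReal φ.integrable_normed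
          (.of_forall φ.nonneg_normed), φ.integral_normed, ENNReal.ofReal_one, one_mul]

theorem enorm_mollify_sub_le_of_mem_ball (φ : ContDiffBump (0 : Rn n)) {g : Rn n → F}
    (hg : LocallyIntegrable g) (a : F) {x y : Rn n} {τ M : ℝ} (hy : y ∈ Metric.ball x τ)
    (hM : ∀ z, φ.normed volume z ≤ M) :
    ‖mollify φ g y - a‖ₑ ≤
      ENNReal.ofReal M * ∫⁻ z in Metric.ball x (τ + φ.rOut), ‖g z - a‖ₑ := by
  refine (enorm_mollify_sub_le φ hg a y).trans ?_
  rw [← lintegral_sub_left_eq_self _ y, ← lintegral_const_mul' _ _ ENNReal.ofReal_ne_top,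
    ← lintegral_indicator Metric.isOpen_ball.measurableSet]
  refine lintegral_mono fun z => ?_
  simp only [sub_sub_cancel]
  rcases le_or_gt φ.rOut ‖y - z‖ with hz | hz
  · simp [normed_eq_zero φ hz]
  · have : z ∈ Metric.ball x (τ + φ.rOut) := by
      rw [mem_ball_iff_norm] at hy ⊢
      calc ‖z - x‖ = ‖(y - x) - (y - z)‖ := by congr 1; abel
        _ ≤ ‖y - x‖ + ‖y - z‖ := norm_sub_le _ _
        _ < _ := by linarith
    rw [indicator_of_mem this]
    gcongr
    exact hM _

theorem volume_ball_eq (x : Rn n) {r : ℝ} (hr : 0 < r) :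
    volume (Metric.ball x r) = ENNReal.ofReal r ^ n * unitBallVolume n := by
  rw [Measure.addHaar_ball_of_pos _ _ hr, finrank_euclideanSpace_fin,
    ENNReal.ofReal_pow hr.le]
  rfl

theorem unitBallVolume_ne_zero : unitBallVolume n ≠ 0 :=
  (Metric.measure_ball_pos _ _ one_pos).ne'

theorem unitBallVolume_ne_top : unitBallVolume n ≠ ⊤ := measure_ball_lt_top.ne

/-- Growth of order `n` of the integral of `‖g - a‖` over balls centred at `x` is inherited by all
mollifications, with a constant that does not depend on the mollification radius. -/
theorem setLIntegral_mollify_sub_le_pow (φ : ContDiffBump (0 : Rn n))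
    (hφ : φ.rOut ≤ 2 * φ.rIn) {g : Rn n → F} (hg : LocallyIntegrable g) (a : F) (x : Rn n)
    {s₀ : ℝ} {η : ℝ≥0∞}
    (hη : ∀ s, 0 < s → s ≤ s₀ → ∫⁻ y in Metric.ball x s, ‖g y - a‖ₑ ≤ η * ENNReal.ofReal s ^ n)
    {τ : ℝ} (hτ : 0 < τ) (hτs : 2 * τ ≤ s₀) (hφs : 2 * φ.rOut ≤ s₀) :
    ∫⁻ y in Metric.ball x τ, ‖mollify φ g y - a‖ₑ ≤ 4 ^ n * η * ENNReal.ofReal τ ^ n := by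
  have h2 : ∀ t : ℝ, ENNReal.ofReal (2 * t) = 2 * ENNReal.ofReal t := fun t => by
    rw [ENNReal.ofReal_mul zero_le_two, ENNReal.ofReal_ofNat]
  rcases le_or_gt φ.rOut τ with h | h
  -- small mollification radius: the mollification only sees `B(x, 2 τ)`
  · calc ∫⁻ y in Metric.ball x τ, ‖mollify φ g y - a‖ₑ
        ≤ ∫⁻ y in Metric.ball x (τ + φ.rOut), ‖g y - a‖ₑ := setLIntegral_mollify_sub_le φ hg a x τ
      _ ≤ ∫⁻ y in Metric.ball x (2 * τ), ‖g y - a‖ₑ :=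
          lintegral_mono_set (Metric.ball_subset_ball (by linarith))
      _ ≤ η * ENNReal.ofReal (2 * τ) ^ n := hη _ (by linarith) hτs
      _ = 2 ^ n * η * ENNReal.ofReal τ ^ n := by rw [h2, mul_pow]; ring
      _ ≤ _ := by gcongr; norm_num
  -- large mollification radius: bound the mollification pointwise on `B(x, τ)` by averages
  · have hδ := φ.rOut_pos
    have hM : ∀ z, φ.normed volume z ≤ 2 ^ n / (volume : Measure (Rn n)).real
        (Metric.closedBall 0 φ.rOut) := fun z => by
      simpa using φ.normed_le_div_measure_closedBall_rOut volume 2 hφ z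
    have hvol : (volume : Measure (Rn n)).real (Metric.closedBall 0 φ.rOut) =
        (ENNReal.ofReal φ.rOut ^ n * unitBallVolume n).toReal := by
      rw [Measure.real, Measure.addHaar_closedBall _ _ hδ.le, finrank_euclideanSpace_fin,
        ENNReal.ofReal_pow hδ.le]
      rfl
    have h0 : ENNReal.ofReal φ.rOut ≠ 0 := by simpa using hδ
    have hne : ENNReal.ofReal φ.rOut ^ n * unitBallVolume n ≠ 0 :=
      mul_ne_zero (pow_ne_zero _ h0) unitBallVolume_ne_zero
    have hnt : ENNReal.ofReal φ.rOut ^ n * unitBallVolume n ≠ ⊤ :=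
      ENNReal.mul_ne_top (ENNReal.pow_ne_top ENNReal.ofReal_ne_top) unitBallVolume_ne_top
    have hMe : ENNReal.ofReal (2 ^ n / (volume : Measure (Rn n)).real
        (Metric.closedBall 0 φ.rOut)) = 2 ^ n / (ENNReal.ofReal φ.rOut ^ n * unitBallVolume n) := by
      rw [hvol, ENNReal.ofReal_div_of_pos (ENNReal.toReal_pos hne hnt), ENNReal.ofReal_toReal hnt,
        ENNReal.ofReal_pow zero_le_two, ENNReal.ofReal_ofNat]
    calc ∫⁻ y in Metric.ball x τ, ‖mollify φ g y - a‖ₑ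
        ≤ ∫⁻ _ in Metric.ball x τ, 2 ^ n / (ENNReal.ofReal φ.rOut ^ n * unitBallVolume n) *
            (η * ENNReal.ofReal (2 * φ.rOut) ^ n) := by
          refine setLIntegral_mono measurable_const fun y hy => ?_
          refine (enorm_mollify_sub_le_of_mem_ball φ hg a hy hM).trans ?_
          rw [hMe]
          gcongr
          exact (lintegral_mono_set (Metric.ball_subset_ball (by linarith))).trans
            (hη _ (by linarith) hφs)
      _ = 4 ^ n * η * ENNReal.ofReal τ ^ n * ((ENNReal.ofReal φ.rOut ^ n * unitBallVolume n) /
            (ENNReal.ofReal φ.rOut ^ n * unitBallVolume n)) := by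
          rw [setLIntegral_const, volume_ball_eq _ hτ, h2, mul_pow,
            show (4 : ℝ≥0∞) = 2 * 2 by norm_num, mul_pow, div_eq_mul_inv, div_eq_mul_inv]
          ring
      _ = _ := by rw [ENNReal.div_self hne hnt, mul_one]

end Mollify

/-! ### Growth of a function controlled by its gradient -/

section Radial

variable {n : ℕ} {F : Type*} [NormedAddCommGroup F] [NormedSpace ℝ F] [CompleteSpace F]

theorem setLIntegral_ball_homothety {Φ : Rn n → ℝ≥0∞} (hΦ : Measurable Φ) (x : Rn n) {t ρ : ℝ}
    (ht : 0 < t) :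
    ∫⁻ y in Metric.ball x ρ, Φ (x + t • (y - x)) =
      (ENNReal.ofReal t ^ n)⁻¹ * ∫⁻ y in Metric.ball x (t * ρ), Φ y := by
  set g : Rn n → ℝ≥0∞ := fun z => (Metric.ball x (t * ρ)).indicator Φ (x + z) with hg
  have hgm : Measurable g :=
    (hΦ.indicator Metric.isOpen_ball.measurableSet).comp (measurable_const_add x)
  calc ∫⁻ y in Metric.ball x ρ, Φ (x + t • (y - x))
      = ∫⁻ y, g (t • (y - x)) := by
        rw [← lintegral_indicator Metric.isOpen_ball.measurableSet]
        refine lintegral_congr fun y => ?_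
        have : x + t • (y - x) ∈ Metric.ball x (t * ρ) ↔ y ∈ Metric.ball x ρ := by
          rw [mem_ball_iff_norm, mem_ball_iff_norm, add_sub_cancel_left, norm_smul,
            Real.norm_of_nonneg ht.le, mul_lt_mul_iff_right₀ ht]
        by_cases hy : y ∈ Metric.ball x ρ
        · simp only [hg, indicator_of_mem hy, indicator_of_mem (this.2 hy)]
        · simp only [hg, indicator_of_notMem hy, indicator_of_notMem (this.not.2 hy)]
    _ = ∫⁻ z, g (t • z) := lintegral_sub_right_eq_self (fun z => g (t • z)) x
    _ = ∫⁻ z, g z ∂(Measure.map (t • ·) volume) :=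
        (lintegral_map hgm (measurable_const_smul t)).symm
    _ = (ENNReal.ofReal t ^ n)⁻¹ * ∫⁻ z, g z := by
        rw [Measure.map_addHaar_smul _ ht.ne', lintegral_smul_measure, finrank_euclideanSpace_fin,
          abs_of_nonneg (by positivity), ENNReal.ofReal_inv_of_pos (by positivity),
          ENNReal.ofReal_pow ht.le, smul_eq_mul]
    _ = _ := by
        rw [lintegral_add_left_eq_self (fun z => (Metric.ball x (t * ρ)).indicator Φ z) x,
          lintegral_indicator Metric.isOpen_ball.measurableSet]

omit [CompleteSpace F] in
/-- If `h x = 0` and the gradient of `h` has integral `O(τ ^ n)` over every ball `B(x, τ)`, then `h`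
is `O(ρ)` on average over `B(x, ρ)`. This replaces the Poincaré inequality: one integrates the
gradient along the segments issuing from `x`. -/
theorem setLIntegral_enorm_le_of_fderiv {h : Rn n → F} (hh : ContDiff ℝ 1 h) {x : Rn n}
    (h0 : h x = 0) {ρ : ℝ} {M : ℝ≥0∞}
    (hM : ∀ τ, 0 < τ → τ ≤ ρ →
      ∫⁻ y in Metric.ball x τ, ‖fderiv ℝ h y‖ₑ ≤ M * ENNReal.ofReal τ ^ n) :
    ∫⁻ y in Metric.ball x ρ, ‖h y‖ₑ ≤ M * ENNReal.ofReal ρ ^ (n + 1) := by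
  rcases le_or_gt ρ 0 with hρ | hρ
  · simp [Metric.ball_eq_empty.2 hρ]
  have hd := hh.continuous_fderiv one_ne_zero
  have hpt : ∀ y ∈ Metric.ball x ρ, ‖h y‖ₑ ≤
      ENNReal.ofReal ρ * ∫⁻ t in Icc (0 : ℝ) 1, ‖fderiv ℝ h (x + t • (y - x))‖ₑ := by
    intro y hy
    set γ : ℝ → Rn n := fun t => x + t • (y - x) with hγ
    have hγd : ∀ t, HasDerivAt γ (y - x) t := fun t => by
      have := ((hasDerivAt_id t).smul_const (y - x)).const_add x
      rwa [one_smul] at this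
    have hc : ContDiff ℝ 1 γ := by fun_prop
    have hder : ∀ t, deriv (h ∘ γ) t = fderiv ℝ h (γ t) (y - x) := fun t =>
      (((hh.differentiable one_ne_zero) (γ t)).hasFDerivAt.comp_hasDerivAt t (hγd t)).deriv
    have := enorm_sub_le_lintegral_deriv_of_contDiffOn_Icc (f := h ∘ γ) (a := 0) (b := 1)
      (hh.comp hc).contDiffOn zero_le_one
    simp only [hγ, Function.comp, one_smul, add_sub_cancel, zero_smul, add_zero, h0,
      sub_zero] at this
    refine this.trans ?_
    rw [← lintegral_const_mul' _ _ ENNReal.ofReal_ne_top]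
    refine lintegral_mono fun t => ?_
    have h1 := hder t
    simp only [hγ] at h1
    rw [h1, mul_comm]
    refine (ContinuousLinearMap.le_opENorm _ _).trans ?_
    gcongr
    rw [← ofReal_norm, ← dist_eq_norm]
    exact ENNReal.ofReal_le_ofReal (Metric.mem_ball.1 hy).le
  have hjoint : Continuous fun p : Rn n × ℝ => ‖fderiv ℝ h (x + p.2 • (p.1 - x))‖ₑ := by
    refine continuous_enorm.comp (hd.comp ?_)
    fun_prop
  calc ∫⁻ y in Metric.ball x ρ, ‖h y‖ₑ
      ≤ ∫⁻ y in Metric.ball x ρ,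
          ENNReal.ofReal ρ * ∫⁻ t in Icc (0 : ℝ) 1, ‖fderiv ℝ h (x + t • (y - x))‖ₑ :=
        setLIntegral_mono' Metric.isOpen_ball.measurableSet hpt
    _ = ENNReal.ofReal ρ * ∫⁻ t in Icc (0 : ℝ) 1, ∫⁻ y in Metric.ball x ρ,
          ‖fderiv ℝ h (x + t • (y - x))‖ₑ := by
        rw [lintegral_const_mul' _ _ ENNReal.ofReal_ne_top]
        congr 1
        exact lintegral_lintegral_swap hjoint.measurable.aemeasurable
    _ ≤ ENNReal.ofReal ρ * ∫⁻ t in Icc (0 : ℝ) 1, M * ENNReal.ofReal ρ ^ n := by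
        gcongr ENNReal.ofReal ρ * ?_
        refine lintegral_mono_ae ?_
        have hne : ∀ᵐ t : ℝ, t ≠ 0 := Measure.ae_ne volume 0
        rw [ae_restrict_iff' measurableSet_Icc]
        filter_upwards [hne] with t ht0 ht
        have ht' : 0 < t := lt_of_le_of_ne ht.1 (Ne.symm ht0)
        rw [setLIntegral_ball_homothety (Φ := fun y => ‖fderiv ℝ h y‖ₑ)
          (continuous_enorm.comp hd).measurable x ht']
        have h1 := hM (t * ρ) (by positivity) (by nlinarith [ht.2])
        calc _ ≤ (ENNReal.ofReal t ^ n)⁻¹ * (M * ENNReal.ofReal (t * ρ) ^ n) := by gcongr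
          _ = (ENNReal.ofReal t ^ n)⁻¹ * ENNReal.ofReal t ^ n * (M * ENNReal.ofReal ρ ^ n) := by
              rw [ENNReal.ofReal_mul ht'.le, mul_pow]; ring
          _ = _ := by
              rw [ENNReal.inv_mul_cancel, one_mul]
              · exact pow_ne_zero _ (by simpa using ht')
              · exact ENNReal.pow_ne_top ENNReal.ofReal_ne_top
    _ = _ := by
        rw [setLIntegral_const, Real.volume_Icc]
        simp only [sub_zero, ENNReal.ofReal_one, mul_one]
        ring

end Radial

/-! ### Thinness of the set where a Sobolev map is far from its linearisation -/

/-- Cutoff functions at all scales, with the scale-invariant gradient bound. -/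
theorem exists_cutoff (n : ℕ) : ∃ C : ℝ, 0 ≤ C ∧ ∀ (x : Rn n) (s : ℝ), 0 < s →
    ∃ ψ : Rn n → ℝ, ContDiff ℝ 1 ψ ∧ HasCompactSupport ψ ∧ (∀ y, 0 ≤ ψ y) ∧ (∀ y, ψ y ≤ 1) ∧
      (∀ y, dist y x ≤ s → ψ y = 1) ∧ (∀ y, y ∉ Metric.ball x (2 * s) → ψ y = 0) ∧
      (∀ y, y ∉ Metric.ball x (2 * s) → fderiv ℝ ψ y = 0) ∧
      ∀ y, ‖fderiv ℝ ψ y‖ ≤ C / s := by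
  let b : ContDiffBump (0 : Rn n) := ⟨1, 3 / 2, one_pos, by norm_num⟩
  have hb : ContDiff ℝ 1 b := b.contDiff
  obtain ⟨C, hC⟩ := (b.hasCompactSupport.fderiv (𝕜 := ℝ)).exists_bound_of_continuous
    (hb.continuous_fderiv one_ne_zero)
  refine ⟨C, (norm_nonneg _).trans (hC 0), fun x s hs => ?_⟩
  have hL : ∀ y : Rn n, HasFDerivAt (fun y : Rn n => s⁻¹ • (y - x))
      (s⁻¹ • ContinuousLinearMap.id ℝ (Rn n)) y := fun y =>
    ((hasFDerivAt_id y).sub_const x).const_smul s⁻¹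
  have hfd : ∀ y, fderiv ℝ (fun y => b (s⁻¹ • (y - x))) y = s⁻¹ • fderiv ℝ b (s⁻¹ • (y - x)) := by
    intro y
    have h1 := ((hb.differentiable one_ne_zero) (s⁻¹ • (y - x))).hasFDerivAt.comp y (hL y)
    rw [show (fun y => b (s⁻¹ • (y - x))) = b ∘ fun y => s⁻¹ • (y - x) from rfl, h1.fderiv]
    ext v
    simp
  have hnorm : ∀ y : Rn n, ‖s⁻¹ • (y - x)‖ = dist y x / s := fun y => by
    rw [norm_smul, Real.norm_of_nonneg (inv_nonneg.2 hs.le), dist_eq_norm, inv_mul_eq_div]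
  have hfar : ∀ y, y ∉ Metric.ball x (2 * s) → s⁻¹ • (y - x) ∉ tsupport b := fun y hy => by
    rw [b.tsupport_eq, mem_closedBall_zero_iff, hnorm, not_le, lt_div_iff₀ hs]
    rw [Metric.mem_ball, not_lt] at hy
    change 3 / 2 * s < _
    linarith
  refine ⟨fun y => b (s⁻¹ • (y - x)), hb.comp (by fun_prop), ?_, fun y => b.nonneg,
    fun y => b.le_one, fun y hy => ?_, fun y hy => ?_, fun y hy => ?_, fun y => ?_⟩
  · refine HasCompactSupport.of_support_subset_isCompact (isCompact_closedBall x (2 * s)) ?_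
    intro y hy
    by_contra h
    exact hy (image_eq_zero_of_notMem_tsupport
      (hfar y fun h' => h (Metric.ball_subset_closedBall h')))
  · refine b.one_of_mem_closedBall ?_
    rw [mem_closedBall_zero_iff, hnorm]
    exact (div_le_one hs).2 hy
  · exact image_eq_zero_of_notMem_tsupport (hfar y hy)
  · rw [hfd, image_eq_zero_of_notMem_tsupport fun h => hfar y hy (tsupport_fderiv_subset ℝ h)]
    exact smul_zero _
  · rw [hfd, norm_smul, Real.norm_of_nonneg (inv_nonneg.2 hs.le), inv_mul_eq_div]
    gcongr
    exact hC _

/-- A smooth substitute for the norm: it vanishes at `0`, is `1`-Lipschitz and exceeds `1` where the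
norm is at least `2`. -/
noncomputable def softNorm {n : ℕ} (w : Rn n) : ℝ := √(1 + ‖w‖ ^ 2) - 1

theorem softNorm_nonneg {n : ℕ} (w : Rn n) : 0 ≤ softNorm w := by
  have : 1 ≤ √(1 + ‖w‖ ^ 2) := Real.one_le_sqrt.2 (by nlinarith [sq_nonneg ‖w‖])
  unfold softNorm
  linarith

theorem softNorm_le {n : ℕ} (w : Rn n) : softNorm w ≤ ‖w‖ := by
  have : √(1 + ‖w‖ ^ 2) ≤ 1 + ‖w‖ :=
    Real.sqrt_le_iff.2 ⟨by positivity, by nlinarith [norm_nonneg w]⟩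
  unfold softNorm
  linarith

theorem one_lt_softNorm {n : ℕ} {w : Rn n} (hw : 2 ≤ ‖w‖) : 1 < softNorm w := by
  have : 2 < √(1 + ‖w‖ ^ 2) := (Real.lt_sqrt (by norm_num)).2 (by nlinarith)
  unfold softNorm
  linarith

theorem contDiff_softNorm {n : ℕ} : ContDiff ℝ 1 (softNorm (n := n)) := by
  unfold softNorm
  exact ((contDiff_const.add (contDiff_norm_sq ℝ)).sqrt fun w => by positivity).sub contDiff_const

theorem norm_fderiv_softNorm_le {n : ℕ} (w : Rn n) : ‖fderiv ℝ (softNorm (n := n)) w‖ ≤ 1 := by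
  refine ContinuousLinearMap.opNorm_le_bound _ zero_le_one fun v => ?_
  have h1 : HasFDerivAt (softNorm (n := n))
      ((1 / (2 * √(1 + ‖w‖ ^ 2))) • (2 • (innerSL ℝ w))) w := by
    have := ((hasStrictFDerivAt_norm_sq w).hasFDerivAt.const_add 1).sqrt
      (by positivity : (1 : ℝ) + ‖w‖ ^ 2 ≠ 0)
    exact this.sub_const 1
  rw [h1.fderiv]
  have hpos : 0 < √(1 + ‖w‖ ^ 2) := Real.sqrt_pos.2 (by positivity)
  have h2 : ‖w‖ ≤ √(1 + ‖w‖ ^ 2) := Real.le_sqrt_of_sq_le (by linarith)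
  have h3 : ((1 / (2 * √(1 + ‖w‖ ^ 2))) • (2 • (innerSL ℝ w))) v =
      inner ℝ w v / √(1 + ‖w‖ ^ 2) := by
    simp only [_root_.smul_apply, innerSL_apply_apply, smul_eq_mul, nsmul_eq_mul, Nat.cast_ofNat]
    field_simp
  rw [h3, norm_div, Real.norm_of_nonneg hpos.le, div_le_iff₀ hpos]
  calc ‖inner ℝ w v‖ ≤ ‖w‖ * ‖v‖ := norm_inner_le_norm w v
    _ ≤ 1 * ‖v‖ * √(1 + ‖w‖ ^ 2) := by nlinarith [norm_nonneg v]

/-- One scale of the capacity estimate: a test function that exceeds `1` at the points of `B(x, s)`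
where `h` is large compared with `s`. It is the product of `softNorm ((c / s) • h)` and a cutoff
function. -/
theorem exists_testFunction {n : ℕ} (hn : n ≠ 0) : ∃ C : ℝ≥0∞, C ≠ ⊤ ∧
    ∀ h : Rn n → Rn n, ContDiff ℝ 1 h → ∀ x, h x = 0 → ∀ s : ℝ, 0 < s → s ≤ 1 → ∀ c : ℝ, 0 < c →
    ∀ M : ℝ≥0∞, (∀ τ, 0 < τ → τ ≤ 2 * s →
      ∫⁻ y in Metric.ball x τ, ‖fderiv ℝ h y‖ₑ ≤ M * ENNReal.ofReal τ ^ n) →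
    ∃ u : Rn n → ℝ, ContDiff ℝ 1 u ∧ HasCompactSupport u ∧ (∀ y, 0 ≤ u y) ∧
      (∀ y, dist y x ≤ s → 2 ≤ c / s * ‖h y‖ → 1 < u y) ∧
      (∫⁻ y, ‖u y‖ₑ) + ∫⁻ y, ‖fderiv ℝ u y‖ₑ ≤
        C * ENNReal.ofReal c * M * ENNReal.ofReal s ^ (n - 1) := by
  obtain ⟨C₁, hC₁, hcut⟩ := exists_cutoff n
  refine ⟨2 ^ (n + 1) + ENNReal.ofReal C₁ * 2 ^ (n + 1) + 2 ^ n, by finiteness, ?_⟩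
  intro h hh x h0 s hs hs1 c hc M hM
  obtain ⟨ψ, hψ, hψc, hψ0, hψ1, hψin, hψout, hdψout, hdψ⟩ := hcut x s hs
  have hcs : 0 < c / s := by positivity
  have hw : ContDiff ℝ 1 fun y => (c / s) • h y := (contDiff_const_smul (c / s)).comp hh
  have hsw : ContDiff ℝ 1 fun y => softNorm ((c / s) • h y) := contDiff_softNorm.comp hw
  have hball : MeasurableSet (Metric.ball x (2 * s)) := Metric.isOpen_ball.measurableSet
  refine ⟨fun y => softNorm ((c / s) • h y) * ψ y, hsw.mul hψ, hψc.mul_left,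
    fun y => mul_nonneg (softNorm_nonneg _) (hψ0 y), fun y hy hy2 => ?_, ?_⟩
  · change 1 < softNorm _ * ψ y
    rw [hψin y hy, mul_one]
    refine one_lt_softNorm ?_
    rwa [norm_smul, Real.norm_of_nonneg hcs.le]
  -- pointwise bounds for the test function and its gradient
  have hu : ∀ y, ‖softNorm ((c / s) • h y) * ψ y‖ₑ ≤
      (Metric.ball x (2 * s)).indicator (fun y => ENNReal.ofReal (c / s) * ‖h y‖ₑ) y := by
    intro y
    by_cases hy : y ∈ Metric.ball x (2 * s)
    · rw [indicator_of_mem hy, ← ofReal_norm, ← ofReal_norm, ← ENNReal.ofReal_mul hcs.le]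
      refine ENNReal.ofReal_le_ofReal ?_
      rw [norm_mul, Real.norm_of_nonneg (softNorm_nonneg _), Real.norm_of_nonneg (hψ0 y)]
      calc _ ≤ softNorm ((c / s) • h y) * 1 :=
            mul_le_mul_of_nonneg_left (hψ1 y) (softNorm_nonneg _)
        _ ≤ ‖(c / s) • h y‖ := by rw [mul_one]; exact softNorm_le _
        _ = _ := by rw [norm_smul, Real.norm_of_nonneg hcs.le]
    · simp [hψout y hy]
  have hdu : ∀ y, ‖fderiv ℝ (fun y => softNorm ((c / s) • h y) * ψ y) y‖ₑ ≤
      (Metric.ball x (2 * s)).indicator (fun y => ENNReal.ofReal (c / s) *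
        (ENNReal.ofReal (C₁ / s) * ‖h y‖ₑ + ‖fderiv ℝ h y‖ₑ)) y := by
    intro y
    have hd1 : HasFDerivAt (fun y => softNorm ((c / s) • h y))
        ((fderiv ℝ softNorm ((c / s) • h y)).comp ((c / s) • fderiv ℝ h y)) y :=
      ((contDiff_softNorm.differentiable one_ne_zero) _).hasFDerivAt.comp y
        (((hh.differentiable one_ne_zero) y).hasFDerivAt.const_smul (c / s))
    have hd2 := (hψ.differentiable one_ne_zero y).hasFDerivAt
    have hd3 : fderiv ℝ (fun y => softNorm ((c / s) • h y) * ψ y) y = _ := (hd1.mul hd2).fderiv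
    rw [hd3]
    by_cases hy : y ∈ Metric.ball x (2 * s)
    · rw [indicator_of_mem hy, ← ofReal_norm, ← ofReal_norm, ← ofReal_norm,
        ← ENNReal.ofReal_mul (by positivity), ← ENNReal.ofReal_add (by positivity) (by positivity),
        ← ENNReal.ofReal_mul hcs.le]
      refine ENNReal.ofReal_le_ofReal ?_
      have e1 : ‖softNorm ((c / s) • h y) • fderiv ℝ ψ y‖ ≤ (c / s * ‖h y‖) * (C₁ / s) := by
        rw [norm_smul, Real.norm_of_nonneg (softNorm_nonneg _)]
        gcongr
        · refine (softNorm_le _).trans_eq ?_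
          rw [norm_smul, Real.norm_of_nonneg hcs.le]
        · exact hdψ y
      have e2 : ‖ψ y • (fderiv ℝ softNorm ((c / s) • h y)).comp ((c / s) • fderiv ℝ h y)‖ ≤
          1 * (1 * (c / s * ‖fderiv ℝ h y‖)) := by
        rw [norm_smul, Real.norm_of_nonneg (hψ0 y)]
        gcongr
        · exact hψ1 y
        · refine (ContinuousLinearMap.opNorm_comp_le _ _).trans ?_
          rw [norm_smul, Real.norm_of_nonneg hcs.le]
          gcongr
          exact norm_fderiv_softNorm_le _
      refine (norm_add_le_of_le e1 e2).trans_eq ?_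
      ring
    · rw [hψout y hy, hdψout y hy, indicator_of_notMem hy, smul_zero, zero_smul, add_zero]
      simp [← ofReal_norm]
  have hh1 := setLIntegral_enorm_le_of_fderiv hh h0 hM
  have hh2 := hM (2 * s) (by positivity) le_rfl
  have hS0 : ENNReal.ofReal s ≠ 0 := by simpa using hs
  have hSS : (ENNReal.ofReal s)⁻¹ * ENNReal.ofReal s = 1 :=
    ENNReal.inv_mul_cancel hS0 ENNReal.ofReal_ne_top
  have hS1 : ENNReal.ofReal s ≤ 1 := by simpa using hs1
  have hI1 : ∫⁻ y, ‖softNorm ((c / s) • h y) * ψ y‖ₑ ≤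
      ENNReal.ofReal (c / s) * (M * ENNReal.ofReal (2 * s) ^ (n + 1)) := by
    refine (lintegral_mono hu).trans ?_
    rw [lintegral_indicator hball, lintegral_const_mul' _ _ ENNReal.ofReal_ne_top]
    gcongr
  have hI2 : ∫⁻ y, ‖fderiv ℝ (fun y => softNorm ((c / s) • h y) * ψ y) y‖ₑ ≤
      ENNReal.ofReal (c / s) * (ENNReal.ofReal (C₁ / s) * (M * ENNReal.ofReal (2 * s) ^ (n + 1)) +
        M * ENNReal.ofReal (2 * s) ^ n) := by
    refine (lintegral_mono hdu).trans ?_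
    rw [lintegral_indicator hball, lintegral_const_mul' _ _ ENNReal.ofReal_ne_top,
      lintegral_add_left (f := fun y => ENNReal.ofReal (C₁ / s) * ‖h y‖ₑ)
        (measurable_const.mul hh.continuous.enorm.measurable),
      lintegral_const_mul' _ _ ENNReal.ofReal_ne_top]
    gcongr
  refine (add_le_add hI1 hI2).trans ?_
  rw [ENNReal.ofReal_div_of_pos hs, ENNReal.ofReal_div_of_pos hs, ENNReal.ofReal_mul zero_le_two,
    ENNReal.ofReal_ofNat]
  obtain ⟨m, rfl⟩ := Nat.exists_eq_succ_of_ne_zero hn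
  rw [Nat.succ_sub_one]
  simp only [Nat.succ_eq_add_one]
  generalize ENNReal.ofReal s = S at *
  generalize ENNReal.ofReal c = c'
  generalize ENNReal.ofReal C₁ = C'
  simp only [div_eq_mul_inv]
  calc _ = 2 ^ (m + 2) * c' * M * (S⁻¹ * S) * (S ^ m * S) +
          (C' * 2 ^ (m + 2) * c' * M * (S⁻¹ * S) * (S⁻¹ * S) * S ^ m +
            2 ^ (m + 1) * c' * M * (S⁻¹ * S) * S ^ m) := by ring
    _ ≤ 2 ^ (m + 2) * c' * M * 1 * (S ^ m * 1) +
          (C' * 2 ^ (m + 2) * c' * M * 1 * 1 * S ^ m + 2 ^ (m + 1) * c' * M * 1 * S ^ m) := by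
        rw [hSS]; gcongr
    _ = _ := by ring

/-- On the ball `B(x, s)`, a Sobolev map `f` is uniformly close to a `C¹` map whose distance to the
affine map `y ↦ f x + A (y - x)` has controlled gradient. -/
theorem exists_contDiff_approx {n : ℕ} {Ω : Set (Rn n)} {f : Rn n → Rn n}
    {G : Rn n → Rn n →L[ℝ] Rn n} (hG : IsWeakGradient Ω f G) (hf : ContinuousOn f Ω) {x : Rn n}
    {R : ℝ} (hR : Metric.closedBall x R ⊆ Ω) (A : Rn n →L[ℝ] Rn n) {η : ℝ≥0∞} {s₀ : ℝ}
    (hsR : s₀ ≤ R)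
    (hη : ∀ s, 0 < s → s ≤ s₀ → ∫⁻ y in Metric.ball x s, ‖G y - A‖ₑ ≤ η * ENNReal.ofReal s ^ n)
    {s : ℝ} (hs : 0 < s) (hs4 : 4 * s ≤ s₀) {κ : ℝ} (hκ : 0 < κ) :
    ∃ h : Rn n → Rn n, ContDiff ℝ 1 h ∧ h x = 0 ∧
      (∀ y, dist y x ≤ s → ‖h y - (f y - f x - A (y - x))‖ ≤ κ) ∧
      ∀ τ, 0 < τ → τ ≤ 2 * s →
        ∫⁻ y in Metric.ball x τ, ‖fderiv ℝ h y‖ₑ ≤ 4 ^ n * η * ENNReal.ofReal τ ^ n := by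
  set S := Metric.closedBall x R with hS
  have hSm : MeasurableSet S := Metric.isClosed_closedBall.measurableSet
  have hSc : IsCompact S := isCompact_closedBall x R
  have hfS : IntegrableOn f S := hG.locallyIntegrableOn.integrableOn_compact_subset hR hSc
  have hGS : IntegrableOn G S := hG.locallyIntegrableOn_grad.integrableOn_compact_subset hR hSc
  obtain ⟨δ₀, hδ₀, hδ⟩ := Metric.uniformContinuousOn_iff.1
    (hSc.uniformContinuousOn_of_continuous (hf.mono hR)) (κ / 2) (by positivity)
  -- a mollification radius at most `s` keeps everything below inside `B(x, 4 s)`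
  set δ := min δ₀ s with hδdef
  have hδpos : 0 < δ := lt_min hδ₀ hs
  have hδs : δ ≤ s := min_le_right _ _
  let φ : ContDiffBump (0 : Rn n) := ⟨δ / 2, δ, by positivity, by linarith⟩
  have hφ : φ.rOut = δ := rfl
  have hfi : LocallyIntegrable (S.indicator f) := locallyIntegrable_indicator hfS hSm
  have hGi : LocallyIntegrable (S.indicator G) := locallyIntegrable_indicator hGS hSm
  have hF := contDiff_mollify φ hfi
  have hsub : ∀ y, dist y x ≤ 2 * s → Metric.closedBall y φ.rOut ⊆ S := fun y hy =>
    Metric.closedBall_subset_closedBall' (by rw [hφ]; linarith)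
  have hclose : ∀ y, dist y x ≤ s → dist (mollify φ (S.indicator f) y) (f y) ≤ κ / 2 := by
    intro y hy
    have hyS : y ∈ S := hsub y (by linarith) (Metric.mem_closedBall_self φ.rOut_pos.le)
    have := ContDiffBump.dist_normed_convolution_le (φ := φ) (x₀ := y) (ε := κ / 2)
      hfi.aestronglyMeasurable fun z hz => by
        have hzS := hsub y (by linarith) (Metric.ball_subset_closedBall hz)
        rw [indicator_of_mem hzS, indicator_of_mem hyS]
        exact (hδ z hzS y hyS ((Metric.mem_ball.1 hz).trans_le (min_le_left _ _))).le
    rwa [indicator_of_mem hyS] at this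
  refine ⟨fun y => mollify φ (S.indicator f) y - mollify φ (S.indicator f) x - A (y - x),
    by fun_prop, by simp, fun y hy => ?_, fun τ hτ hτs => ?_⟩
  · have h1 := hclose y hy
    have h2 := hclose x (by simpa using hs.le)
    rw [dist_eq_norm] at h1 h2
    calc _ = ‖(mollify φ (S.indicator f) y - f y) - (mollify φ (S.indicator f) x - f x)‖ := by
          congr 1; beta_reduce; generalize A (y - x) = a; abel
      _ ≤ κ := (norm_sub_le _ _).trans (by linarith)
  · have hd : ∀ y ∈ Metric.ball x τ,
        fderiv ℝ (fun y => mollify φ (S.indicator f) y - mollify φ (S.indicator f) x - A (y - x)) y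
          = mollify φ (S.indicator G) y - A := by
      intro y hy
      have h1 : HasFDerivAt (fun y => A (y - x)) A y := by
        have := A.hasFDerivAt.comp y ((hasFDerivAt_id y).sub_const x)
        rwa [ContinuousLinearMap.comp_id] at this
      have h2 := (((hF.differentiable one_ne_zero y).hasFDerivAt.sub_const
        (mollify φ (S.indicator f) x)).sub h1).fderiv
      rw [fderiv_mollify φ hG hSm hR hfS hGS (hsub y ((Metric.mem_ball.1 hy).le.trans hτs))] at h2
      exact h2
    rw [setLIntegral_congr_fun (g := fun y => ‖mollify φ (S.indicator G) y - A‖ₑ)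
      Metric.isOpen_ball.measurableSet fun y hy => by simp only [hd y hy]]
    refine setLIntegral_mollify_sub_le_pow φ (by change δ ≤ 2 * (δ / 2); linarith) hGi A x
      (s₀ := s₀) (fun t ht hts => ?_) hτ (by linarith) (by rw [hφ]; linarith)
    refine (setLIntegral_congr_fun Metric.isOpen_ball.measurableSet fun y hy => ?_).trans_le
      (hη t ht hts)
    have : y ∈ S := Metric.ball_subset_closedBall
      (Metric.ball_subset_ball (hts.trans hsR) hy)
    simp only [indicator_of_mem this]

/-- The capacity estimate behind fine differentiability: the set where `f` deviates from its
linearisation at `x` by more than `ε ‖y - x‖` is covered dyadically by test functions built from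
smooth approximations of the deviation. -/
theorem capOne_deviation_le {n : ℕ} (hn : 2 ≤ n) : ∃ C : ℝ≥0∞, C ≠ ⊤ ∧
    ∀ (Ω : Set (Rn n)) (f : Rn n → Rn n) (G : Rn n → Rn n →L[ℝ] Rn n), IsWeakGradient Ω f G →
    ContinuousOn f Ω → ∀ (x : Rn n) (R : ℝ), Metric.closedBall x R ⊆ Ω →
    ∀ (A : Rn n →L[ℝ] Rn n) (η : ℝ≥0∞) (s₀ : ℝ), s₀ ≤ R →
    (∀ s, 0 < s → s ≤ s₀ → ∫⁻ y in Metric.ball x s, ‖G y - A‖ₑ ≤ η * ENNReal.ofReal s ^ n) →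
    ∀ (ε : ℝ), 0 < ε → ∀ r : ℝ, 0 < r → r ≤ 1 → 4 * r ≤ s₀ →
    capOne {y | y ∈ Metric.ball x r ∧ y ≠ x ∧ ε * dist y x ≤ ‖f y - f x - A (y - x)‖} ≤
      C * ENNReal.ofReal (8 / ε) * η * ENNReal.ofReal r ^ (n - 1) := by
  obtain ⟨C, hC, hT⟩ := exists_testFunction (n := n) (by omega)
  refine ⟨2 * C * 4 ^ n, by finiteness, ?_⟩
  intro Ω f G hG hf x R hR A η s₀ hsR hη ε hε r hr hr1 hrs
  set s : ℕ → ℝ := fun k => r * (1 / 2) ^ k with hs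
  have hspos : ∀ k, 0 < s k := fun k => by positivity
  have hsr : ∀ k, s k ≤ r := fun k =>
    mul_le_of_le_one_right hr.le (pow_le_one₀ (by norm_num) (by norm_num))
  have hscale : ∀ k, ∃ u : Rn n → ℝ, ContDiff ℝ 1 u ∧ HasCompactSupport u ∧ (∀ y, 0 ≤ u y) ∧
      (∀ y, dist y x ≤ s k → s k / 2 ≤ dist y x → ε * dist y x ≤ ‖f y - f x - A (y - x)‖ →
        1 < u y) ∧
      (∫⁻ y, ‖u y‖ₑ) + ∫⁻ y, ‖fderiv ℝ u y‖ₑ ≤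
        C * ENNReal.ofReal (8 / ε) * (4 ^ n * η) * ENNReal.ofReal (s k) ^ (n - 1) := by
    intro k
    have hsk := hspos k
    -- on the annulus the deviation is at least `ε s / 2`; an error of `ε s / 4` leaves `ε s / 4`,
    -- which the factor `8 / (ε s)` raises to the threshold `2` of `softNorm`
    obtain ⟨h, hh, h0, hclose, hM⟩ := exists_contDiff_approx hG hf hR A hsR hη hsk
      (by linarith [hsr k]) (κ := ε * s k / 4) (by positivity)
    obtain ⟨u, hu, huc, hu0, hu1, hu2⟩ := hT h hh x h0 (s k) hsk ((hsr k).trans hr1) (8 / ε)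
      (by positivity) (4 ^ n * η) hM
    refine ⟨u, hu, huc, hu0, fun y hy1 hy2 hy3 => hu1 y hy1 ?_, hu2⟩
    have h1 := hclose y hy1
    have h2 : ‖f y - f x - A (y - x)‖ ≤ ‖h y‖ + ε * s k / 4 := by
      have := norm_sub_le (h y) (h y - (f y - f x - A (y - x)))
      rw [sub_sub_cancel] at this
      linarith
    have h3 : ε * (s k / 2) ≤ ε * dist y x := by gcongr
    have h4 : ε * s k / 4 ≤ ‖h y‖ := by linarith
    rw [div_div, div_mul_eq_mul_div, le_div_iff₀ (by positivity)]
    linarith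
  choose u hu huc hu0 hu1 hu2 using hscale
  refine (capOne_le_tsum u hu huc hu0 ?_).trans ?_
  · rintro y ⟨hy1, hy2, hy3⟩
    have hd : 0 < dist y x := dist_pos.2 hy2
    rw [Metric.mem_ball] at hy1
    obtain ⟨k, hk1, hk2⟩ := exists_nat_pow_near_of_lt_one (x := dist y x / r) (y := 1 / 2)
      (by positivity) ((div_le_one hr).2 hy1.le) (by norm_num) (by norm_num)
    rw [div_le_iff₀ hr] at hk2
    rw [lt_div_iff₀ hr] at hk1
    refine mem_iUnion.2 ⟨k, hu1 k y (by simp only [hs]; linarith) ?_ hy3⟩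
    simp only [hs]
    rw [pow_succ] at hk1
    linarith
  · have hgeo : ∀ k, ENNReal.ofReal (s k) ^ (n - 1) ≤
        ENNReal.ofReal r ^ (n - 1) * (2⁻¹ : ℝ≥0∞) ^ k := by
      intro k
      have h2 : ENNReal.ofReal (1 / 2) = 2⁻¹ := by
        rw [one_div, ENNReal.ofReal_inv_of_pos two_pos, ENNReal.ofReal_ofNat]
      rw [hs, ENNReal.ofReal_mul hr.le, mul_pow, ENNReal.ofReal_pow (by norm_num), h2]
      have hk : (2⁻¹ : ℝ≥0∞) ^ k ≤ 1 := pow_le_one₀ (by simp) (by simp)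
      refine mul_le_mul_right ?_ _
      exact pow_le_of_le_one bot_le hk (show n - 1 ≠ 0 by omega)
    calc ∑' k, ((∫⁻ y, ‖u k y‖ₑ) + ∫⁻ y, ‖fderiv ℝ (u k) y‖ₑ)
        ≤ ∑' k, C * ENNReal.ofReal (8 / ε) * (4 ^ n * η) *
            (ENNReal.ofReal r ^ (n - 1) * (2⁻¹ : ℝ≥0∞) ^ k) := by
          refine ENNReal.tsum_le_tsum fun k => (hu2 k).trans ?_
          gcongr
          exact hgeo k
      _ = _ := by
          rw [ENNReal.tsum_mul_left, ENNReal.tsum_mul_left, ENNReal.tsum_geometric,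
            ENNReal.one_sub_inv_two, inv_inv]
          ring

/-! ### Thin sets have density zero -/

theorem one_le_mollify {n : ℕ} (φ : ContDiffBump (0 : Rn n)) {u : Rn n → ℝ}
    (hu : LocallyIntegrable u) {W : Set (Rn n)} (hW : MeasurableSet W)
    (h1 : ∀ᵐ x ∂(volume.restrict W), 1 ≤ u x) {y : Rn n} (hy : Metric.ball y φ.rOut ⊆ W) :
    1 ≤ mollify φ u y := by
  have hR : Integrable fun t => φ.normed volume t • u (y - t) :=
    φ.hasCompactSupport_normed.convolutionExists_left (ContinuousLinearMap.lsmul ℝ ℝ)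
      φ.continuous_normed hu y
  rw [← φ.integral_normed (μ := volume)]
  refine integral_mono_ae φ.integrable_normed hR ?_
  rw [ae_restrict_iff' hW] at h1
  have h2 := (quasiMeasurePreserving_sub_left volume y).ae h1
  filter_upwards [h2] with z hz
  rcases le_or_gt φ.rOut ‖z‖ with hz' | hz'
  · simp [normed_eq_zero φ hz']
  · have : y - z ∈ W := hy (by rwa [mem_ball_iff_norm, sub_sub_cancel_left, norm_neg])
    exact le_mul_of_one_le_right (φ.nonneg_normed z) (hz this)

/-- The isoperimetric-type lower bound for the capacity, a consequence of the
Gagliardo–Nirenberg–Sobolev inequality applied to truncated mollifications. -/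
theorem volume_rpow_le_capOne {n : ℕ} {p : ℝ} (hp : Real.HolderConjugate n p) :
    ∃ C : ℝ≥0∞, C ≠ 0 ∧ C ≠ ⊤ ∧ ∀ (x : Rn n) (A : Set (Rn n)), A ⊆ Metric.ball x 1 →
      volume A ^ (1 / p) ≤ C * capOne A := by
  obtain ⟨C₁, hC₁, hcut⟩ := exists_cutoff n
  set C₀ : ℝ≥0∞ := (lintegralPowLePowLIntegralFDerivConst (volume : Measure (Rn n)) p : ℝ≥0∞)
  have hp0 : 0 < p := hp.symm.pos
  set D : ℝ≥0∞ := ENNReal.ofReal C₁ + 1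
  set C : ℝ≥0∞ := (C₀ + 1) ^ (1 / p) * D
  have hCt : C ≠ ⊤ := ENNReal.mul_ne_top
    (ENNReal.rpow_ne_top_of_nonneg (by positivity) (by simp [C₀])) (by simp [D])
  have hC0 : C ≠ 0 := mul_ne_zero
    (by simp [ENNReal.rpow_eq_zero_iff, hp0.not_gt]) (by simp [D])
  refine ⟨C, hC0, hCt, fun x A hA => ?_⟩
  rw [mul_comm, ← ENNReal.div_le_iff hC0 hCt]
  refine le_iInf fun u => le_iInf fun g => le_iInf fun hu => le_iInf fun hg => le_iInf fun hw =>
    le_iInf fun hW => ?_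
  obtain ⟨W, hWo, hAW, h1⟩ := hW
  rw [ENNReal.div_le_iff hC0 hCt, mul_comm]
  set N : ℝ≥0∞ := (∫⁻ x, ‖u x‖ₑ) + ∫⁻ x, ‖g x‖ₑ with hN
  obtain ⟨ψ, hψ, hψc, hψ0, hψ1, hψin, hψout, hdψout, hdψ⟩ := hcut x 1 one_pos
  -- the estimate for a fixed mollification
  have key : ∀ δ : ℝ, 0 < δ →
      volume {y | y ∈ Metric.ball x 1 ∧ Metric.ball y δ ⊆ W} ≤ C₀ * (D * N) ^ p := by
    intro δ hδ
    let φ : ContDiffBump (0 : Rn n) := ⟨δ / 2, δ, by positivity, by linarith⟩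
    have hm := contDiff_mollify φ hu.locallyIntegrable
    set v : Rn n → ℝ := fun y => mollify φ u y * ψ y with hv
    have hvc : ContDiff ℝ 1 v := hm.mul hψ
    have hvs : HasCompactSupport v := hψc.mul_left
    have hdm : ∀ y, fderiv ℝ (mollify φ u) y = mollify φ g y := fun y => by
      have := fderiv_mollify φ hw MeasurableSet.univ (subset_refl _) hu.integrableOn
        hg.integrableOn (y := y) (subset_univ _)
      rwa [indicator_univ, indicator_univ] at this
    have hdv : ∀ y, ‖fderiv ℝ v y‖ₑ ≤ (Metric.ball x (2 * 1)).indicator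
        (fun y => ENNReal.ofReal C₁ * ‖mollify φ u y - 0‖ₑ + ‖mollify φ g y - 0‖ₑ) y := by
      intro y
      have hd : fderiv ℝ v y = _ := ((hm.differentiable one_ne_zero y).hasFDerivAt.mul
        (hψ.differentiable one_ne_zero y).hasFDerivAt).fderiv
      rw [hd, hdm]
      by_cases hy : y ∈ Metric.ball x (2 * 1)
      · rw [indicator_of_mem hy, sub_zero, sub_zero, ← ofReal_norm, ← ofReal_norm, ← ofReal_norm,
          ← ENNReal.ofReal_mul hC₁, ← ENNReal.ofReal_add (by positivity) (by positivity)]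
        refine ENNReal.ofReal_le_ofReal (norm_add_le_of_le ?_ ?_)
        · rw [norm_smul, mul_comm]
          have := hdψ y
          rw [div_one] at this
          gcongr
        · rw [norm_smul, Real.norm_of_nonneg (hψ0 y)]
          exact mul_le_of_le_one_left (norm_nonneg _) (hψ1 y)
      · rw [hψout y hy, hdψout y hy, indicator_of_notMem hy, smul_zero, zero_smul, add_zero]
        simp [← ofReal_norm]
    have hball : MeasurableSet (Metric.ball x (2 * 1)) := Metric.isOpen_ball.measurableSet
    have hI : ∫⁻ y, ‖fderiv ℝ v y‖ₑ ≤ D * N := by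
      refine (lintegral_mono hdv).trans ?_
      rw [lintegral_indicator hball, lintegral_add_left
        (f := fun y => ENNReal.ofReal C₁ * ‖mollify φ u y - 0‖ₑ)
        (measurable_const.mul (hm.continuous.sub continuous_const).enorm.measurable),
        lintegral_const_mul' _ _ ENNReal.ofReal_ne_top]
      have e1 : ∫⁻ y in Metric.ball x (2 * 1), ‖mollify φ u y - 0‖ₑ ≤ ∫⁻ x, ‖u x‖ₑ := by
        refine (setLIntegral_mollify_sub_le φ hu.locallyIntegrable 0 x _).trans ?_
        simp only [sub_zero]
        exact setLIntegral_le_lintegral _ _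
      have e2 : ∫⁻ y in Metric.ball x (2 * 1), ‖mollify φ g y - 0‖ₑ ≤ ∫⁻ x, ‖g x‖ₑ := by
        refine (setLIntegral_mollify_sub_le φ hg.locallyIntegrable 0 x _).trans ?_
        simp only [sub_zero]
        exact setLIntegral_le_lintegral _ _
      calc _ ≤ ENNReal.ofReal C₁ * (∫⁻ x, ‖u x‖ₑ) + ∫⁻ x, ‖g x‖ₑ := by gcongr
        _ ≤ ENNReal.ofReal C₁ * N + N := by gcongr <;> simp [hN]
        _ = D * N := by simp only [D]; ring
    have hGNS := lintegral_pow_le_pow_lintegral_fderiv (μ := (volume : Measure (Rn n))) hvc hvs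
      (p := p) (by rwa [finrank_euclideanSpace_fin])
    have hsub : {y | y ∈ Metric.ball x 1 ∧ Metric.ball y δ ⊆ W} ⊆ {y | 1 ≤ ‖v y‖ₑ ^ p} := by
      rintro y ⟨hy1, hy2⟩
      have h2 : 1 ≤ mollify φ u y :=
        one_le_mollify φ hu.locallyIntegrable hWo.measurableSet h1 hy2
      have h3 : v y = mollify φ u y := by
        simp only [hv]
        rw [hψin y (Metric.mem_ball.1 hy1).le, mul_one]
      refine ENNReal.one_le_rpow ?_ hp0
      rw [h3, ← ofReal_norm, ENNReal.one_le_ofReal]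
      exact h2.trans (le_abs_self _)
    have hmk := mul_meas_ge_le_lintegral (μ := volume) (f := fun y => ‖v y‖ₑ ^ p)
      (hvc.continuous.enorm.measurable.pow_const p) 1
    rw [one_mul] at hmk
    calc _ ≤ _ := measure_mono hsub
      _ ≤ _ := hmk
      _ ≤ _ := hGNS
      _ ≤ _ := by gcongr
  have hvol : volume A ≤ C₀ * (D * N) ^ p := by
    have hcov : A ⊆ ⋃ k : ℕ, {y | y ∈ Metric.ball x 1 ∧ Metric.ball y (1 / (k + 1 : ℝ)) ⊆ W} := by
      intro y hy
      obtain ⟨δ, hδ, hδW⟩ := Metric.isOpen_iff.1 hWo y (hAW hy)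
      obtain ⟨k, hk⟩ := exists_nat_one_div_lt hδ
      exact mem_iUnion.2 ⟨k, hA hy, (Metric.ball_subset_ball hk.le).trans hδW⟩
    refine (measure_mono hcov).trans ?_
    rw [Monotone.measure_iUnion]
    · exact iSup_le fun k => key _ (by positivity)
    · intro i j hij y hy
      refine ⟨hy.1, (Metric.ball_subset_ball ?_).trans hy.2⟩
      gcongr
  calc volume A ^ (1 / p) ≤ (C₀ * (D * N) ^ p) ^ (1 / p) := by gcongr
    _ = C₀ ^ (1 / p) * (D * N) := by
        rw [ENNReal.mul_rpow_of_nonneg _ _ (by positivity), ← ENNReal.rpow_mul,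
          mul_one_div_cancel hp0.ne', ENNReal.rpow_one]
    _ ≤ (C₀ + 1) ^ (1 / p) * (D * N) := by gcongr; simp
    _ = C * N := by simp only [C]; ring

/-- `A` has Lebesgue (outer) density zero at `x`. -/
def HasDensityZeroAt {n : ℕ} (A : Set (Rn n)) (x : Rn n) : Prop :=
  ∀ θ : ℝ≥0∞, θ ≠ 0 → ∀ᶠ r : ℝ in 𝓝[>] 0, volume (A ∩ Metric.ball x r) ≤ θ * ENNReal.ofReal r ^ n

theorem IsThinAt.hasDensityZeroAt {n : ℕ} (hn : 2 ≤ n) {A : Set (Rn n)} {x : Rn n}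
    (hA : IsThinAt A x) : HasDensityZeroAt A x := by
  intro θ hθ
  have hn1 : (1 : ℝ) < n := by exact_mod_cast (by omega : 1 < n)
  have hp : Real.HolderConjugate (n : ℝ) (n / (n - 1)) := Real.HolderConjugate.conjExponent hn1
  obtain ⟨C, hC0, hCt, hC⟩ := volume_rpow_le_capOne hp
  set p : ℝ := n / (n - 1) with hpdef
  have hp0 : 0 < p := hp.symm.pos
  have hκ : 0 < θ ^ (1 / p) / C := by
    refine ENNReal.div_pos ?_ hCt
    simp [ENNReal.rpow_eq_zero_iff, hθ, hp0.not_gt]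
  have hlt : ∀ᶠ r : ℝ in 𝓝[>] 0, r < 1 :=
    eventually_nhdsWithin_of_eventually_nhds (eventually_lt_nhds one_pos)
  filter_upwards [hA.eventually_lt_const hκ, hlt, self_mem_nhdsWithin] with r hr hr1 hr0
  have hR0 : ENNReal.ofReal r ^ (n - 1) ≠ 0 := pow_ne_zero _ (by simpa using hr0)
  have hRt : ENNReal.ofReal r ^ (n - 1) ≠ ⊤ := ENNReal.pow_ne_top ENNReal.ofReal_ne_top
  have h1 : capOne (A ∩ Metric.ball x r) ≤ θ ^ (1 / p) / C * ENNReal.ofReal r ^ (n - 1) :=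
    (ENNReal.div_le_iff hR0 hRt).1 hr.le
  have h2 := hC x (A ∩ Metric.ball x r)
    (inter_subset_right.trans (Metric.ball_subset_ball hr1.le))
  have h3 : volume (A ∩ Metric.ball x r) ^ (1 / p) ≤
      θ ^ (1 / p) * ENNReal.ofReal r ^ (n - 1) :=
    calc _ ≤ C * (θ ^ (1 / p) / C * ENNReal.ofReal r ^ (n - 1)) := h2.trans (by gcongr)
      _ = _ := by rw [← mul_assoc, ENNReal.mul_div_cancel hC0 hCt]
  have h4 := ENNReal.rpow_le_rpow h3 hp0.le
  rw [← ENNReal.rpow_mul, one_div_mul_cancel hp0.ne', ENNReal.rpow_one,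
    ENNReal.mul_rpow_of_nonneg _ _ hp0.le, ← ENNReal.rpow_mul, one_div_mul_cancel hp0.ne',
    ENNReal.rpow_one, ← ENNReal.rpow_natCast, ← ENNReal.rpow_mul] at h4
  have h5 : ((n - 1 : ℕ) : ℝ) * p = n := by
    rw [Nat.cast_sub (by omega), Nat.cast_one, hpdef]
    field_simp [sub_ne_zero.2 hn1.ne']
  rwa [h5, ENNReal.rpow_natCast] at h4

/-! ### Images of balls under maps with a fine linearisation -/

/-- The points `y ≠ x` at which `f` deviates from the affine map with slope `A` through `(x, f x)`
by at least `ε ‖y - x‖`. -/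
def deviationSet {n : ℕ} (f : Rn n → Rn n) (x : Rn n) (A : Rn n →L[ℝ] Rn n) (ε : ℝ) :
    Set (Rn n) :=
  {y | y ≠ x ∧ ε * dist y x ≤ ‖f y - f x - A (y - x)‖}

/-- Lebesgue points of the weak gradient are points of fine differentiability. -/
theorem isThinAt_deviationSet {n : ℕ} (hn : 2 ≤ n) {Ω : Set (Rn n)} (hΩ : IsOpen Ω)
    {f : Rn n → Rn n} {G : Rn n → Rn n →L[ℝ] Rn n} (hG : IsWeakGradient Ω f G)
    (hf : ContinuousOn f Ω) {x : Rn n} (hx : x ∈ Ω) {A : Rn n →L[ℝ] Rn n}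
    (hA : Tendsto (fun r : ℝ => (∫⁻ y in Metric.ball x r, ‖G y - A‖ₑ) / ENNReal.ofReal r ^ n)
      (𝓝[>] 0) (𝓝 0)) {ε : ℝ} (hε : 0 < ε) : IsThinAt (deviationSet f x A ε) x := by
  obtain ⟨C, hC, hcap⟩ := capOne_deviation_le hn
  obtain ⟨R, hR, hRΩ⟩ := Metric.nhds_basis_closedBall.mem_iff.1 (hΩ.mem_nhds hx)
  refine ENNReal.tendsto_nhds_zero.2 fun θ hθ => ?_
  set D : ℝ≥0∞ := C * ENNReal.ofReal (8 / ε) with hD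
  have hDt : D ≠ ⊤ := ENNReal.mul_ne_top hC ENNReal.ofReal_ne_top
  obtain ⟨η, hη0, hη⟩ : ∃ η : ℝ≥0∞, 0 < η ∧ D * η ≤ θ := by
    refine ⟨θ / (D + 1), ENNReal.div_pos hθ.ne' (by finiteness), ?_⟩
    calc D * (θ / (D + 1)) ≤ (D + 1) * (θ / (D + 1)) := by gcongr; simp
      _ ≤ θ := ENNReal.mul_div_le
  obtain ⟨s₁, hs₁, hlt⟩ := (mem_nhdsGT_iff_exists_Ioo_subset).1 (hA.eventually_lt_const hη0)
  have hs₁' : 0 < s₁ := hs₁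
  set s₀ := min R (s₁ / 2) with hs₀
  have hs₀pos : 0 < s₀ := lt_min hR (by positivity)
  have hs₀1 : s₀ < s₁ := (min_le_right _ _).trans_lt (by linarith)
  have hgrow : ∀ s, 0 < s → s ≤ s₀ →
      ∫⁻ y in Metric.ball x s, ‖G y - A‖ₑ ≤ η * ENNReal.ofReal s ^ n := by
    intro s hs hss
    have h1 : (∫⁻ y in Metric.ball x s, ‖G y - A‖ₑ) / ENNReal.ofReal s ^ n < η :=
      hlt ⟨hs, hss.trans_lt hs₀1⟩
    refine (ENNReal.div_le_iff ?_ ?_).1 h1.le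
    · exact pow_ne_zero _ (by simpa using hs)
    · exact ENNReal.pow_ne_top ENNReal.ofReal_ne_top
  have hsmall : ∀ᶠ r : ℝ in 𝓝[>] 0, r < min 1 (s₀ / 4) :=
    eventually_nhdsWithin_of_eventually_nhds (eventually_lt_nhds (by positivity))
  filter_upwards [hsmall, self_mem_nhdsWithin] with r hr hr0
  have hr0' : 0 < r := hr0
  have h1 := hcap Ω f G hG hf x R hRΩ A η s₀ (min_le_left _ _) hgrow ε hε r hr0'
    (hr.le.trans (min_le_left _ _)) (by linarith [hr.trans_le (min_le_right _ _)])
  refine ENNReal.div_le_of_le_mul ((capOne_mono ?_).trans (h1.trans ?_))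
  · exact fun y hy => ⟨hy.2, hy.1⟩
  · gcongr

/-- If the deviation set is thin at `x`, then removing it from a ball centred at `x` leaves a finely
open set: away from the centre, what remains is open because `f` is continuous. -/
theorem isFinelyOpen_ball_diff_deviationSet {n : ℕ} {f : Rn n → Rn n} {x : Rn n}
    {A : Rn n →L[ℝ] Rn n} {R ε : ℝ} (hR : 0 < R) (hf : ContinuousOn f (Metric.ball x R))
    (hthin : IsThinAt (deviationSet f x A ε) x) :
    IsFinelyOpen (Metric.ball x R \ deviationSet f x A ε) := by
  intro y hy
  by_cases hyx : y = x
  · subst hyx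
    refine tendsto_of_tendsto_of_tendsto_of_le_of_le' tendsto_const_nhds hthin
      (.of_forall fun _ => zero_le) ?_
    have hsmall : ∀ᶠ r : ℝ in 𝓝[>] 0, r < R :=
      eventually_nhdsWithin_of_eventually_nhds (eventually_lt_nhds hR)
    filter_upwards [hsmall] with r hr
    gcongr
    refine capOne_mono fun z hz => ⟨?_, hz.2⟩
    by_contra h
    exact hz.1 ⟨Metric.ball_subset_ball hr.le hz.2, h⟩
  · -- near `y ≠ x` the set is open
    have hopen : IsOpen (Metric.ball x R ∩
        {z | ‖f z - f x - A (z - x)‖ - ε * dist z x < 0}) := by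
      have hc : ContinuousOn (fun z => ‖f z - f x - A (z - x)‖ - ε * dist z x)
          (Metric.ball x R) := by fun_prop
      exact hc.isOpen_inter_preimage Metric.isOpen_ball isOpen_Iio
    have hyV : y ∈ Metric.ball x R ∩ {z | ‖f z - f x - A (z - x)‖ - ε * dist z x < 0} := by
      refine ⟨hy.1, ?_⟩
      have := hy.2
      simp only [deviationSet, mem_ofPred_eq, not_and, not_le] at this
      exact sub_neg.2 (this hyx)
    obtain ⟨δ, hδ, hsub⟩ := Metric.isOpen_iff.1 hopen y hyV
    refine tendsto_const_nhds.congr' ?_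
    have hsmall : ∀ᶠ r : ℝ in 𝓝[>] 0, r < δ :=
      eventually_nhdsWithin_of_eventually_nhds (eventually_lt_nhds hδ)
    filter_upwards [hsmall] with r hr
    have : (Metric.ball x R \ deviationSet f x A ε)ᶜ ∩ Metric.ball y r = ∅ := by
      refine eq_empty_of_forall_notMem fun z hz => ?_
      have hzV := hsub (Metric.ball_subset_ball hr.le hz.2)
      exact hz.1 ⟨hzV.1, fun h => (sub_neg.1 hzV.2).not_ge h.2⟩
    rw [this, capOne_empty, ENNReal.zero_div]

theorem ediam_image_le {n : ℕ} {f : Rn n → Rn n} {x : Rn n} {A : Rn n →L[ℝ] Rn n} {ε r : ℝ}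
    (hε : 0 ≤ ε) {U : Set (Rn n)} (hU : U ⊆ (deviationSet f x A ε)ᶜ) :
    Metric.ediam (f '' (Metric.ball x r ∩ U)) ≤
      ENNReal.ofReal (2 * (‖A‖ + ε)) * ENNReal.ofReal r := by
  refine Metric.ediam_le ?_
  rintro _ ⟨y, ⟨hy, hyU⟩, rfl⟩ _ ⟨z, ⟨hz, hzU⟩, rfl⟩
  have hdev : ∀ w ∈ Metric.ball x r, w ∈ U → ‖f w - f x - A (w - x)‖ ≤ ε * r := by
    intro w hw hwU
    by_cases hwx : w = x
    · subst hwx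
      have := Metric.pos_of_mem_ball hw
      simp only [sub_self, map_zero, norm_zero]
      positivity
    · have := hU hwU
      simp only [deviationSet, mem_compl_iff, mem_ofPred_eq, not_and, not_le] at this
      refine (this hwx).le.trans ?_
      gcongr
      exact (Metric.mem_ball.1 hw).le
  have hlin : ∀ w ∈ Metric.ball x r, ‖A (w - x)‖ ≤ ‖A‖ * r := fun w hw =>
    (A.le_opNorm _).trans (by gcongr; rw [← dist_eq_norm]; exact (Metric.mem_ball.1 hw).le)
  have hr := Metric.pos_of_mem_ball hy
  rw [edist_dist, ← ENNReal.ofReal_mul (by positivity)]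
  refine ENNReal.ofReal_le_ofReal ?_
  rw [dist_eq_norm]
  have e1 := hdev y hy hyU
  have e2 := hdev z hz hzU
  have e3 := hlin y hy
  have e4 := hlin z hz
  calc ‖f y - f z‖ = ‖((f y - f x - A (y - x)) - (f z - f x - A (z - x))) +
        (A (y - x) - A (z - x))‖ := by congr 1; abel
    _ ≤ ‖f y - f x - A (y - x)‖ + ‖f z - f x - A (z - x)‖ + (‖A (y - x)‖ + ‖A (z - x)‖) :=
        (norm_add_le _ _).trans (add_le_add (norm_sub_le _ _) (norm_sub_le _ _))
    _ ≤ _ := by linarith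

/-- If `Uᶜ` and the deviation set both have density zero at `x`, then `U` contains points close to
the two ends of a diameter of `B(x, r)` in a direction where `A` almost attains its norm, and `f`
separates these points almost as much as `A` does. -/
theorem eventually_le_ediam_image {n : ℕ} {f : Rn n → Rn n} {x : Rn n} {A : Rn n →L[ℝ] Rn n}
    {ε : ℝ} (hε : 0 < ε) {U : Set (Rn n)} (hU : HasDensityZeroAt Uᶜ x)
    (hdev : HasDensityZeroAt (deviationSet f x A ε) x) :
    ∀ᶠ r : ℝ in 𝓝[>] 0, ENNReal.ofReal (2 * ‖A‖ - 8 * ε) * ENNReal.ofReal r ≤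
      Metric.ediam (f '' (Metric.ball x r ∩ U)) := by
  rcases le_or_gt (2 * ‖A‖ - 8 * ε) 0 with hneg | hpos
  · exact .of_forall fun r => by rw [ENNReal.ofReal_of_nonpos hneg, zero_mul]; exact zero_le
  have hApos : 0 < ‖A‖ := by linarith
  obtain ⟨v, hv1, hv⟩ := A.exists_lt_apply_of_lt_opNorm (r := ‖A‖ - ε) (by linarith)
  set κ : ℝ := ε / ‖A‖ with hκ
  have hκ0 : 0 < κ := by positivity
  have hκA : κ * ‖A‖ = ε := by rw [hκ]; field_simp
  have hκ1 : κ < 1 := by rw [hκ, div_lt_one hApos]; linarith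
  -- two sets of density `θ` cannot fill a ball of radius `κ r`
  set θ : ℝ≥0∞ := ENNReal.ofReal κ ^ n * unitBallVolume n / 4 with hθ
  have hθ' : ENNReal.ofReal κ ^ n * unitBallVolume n ≠ 0 :=
    mul_ne_zero (pow_ne_zero _ (by simpa using hκ0)) unitBallVolume_ne_zero
  have hθ'' : ENNReal.ofReal κ ^ n * unitBallVolume n ≠ ⊤ :=
    ENNReal.mul_ne_top (ENNReal.pow_ne_top ENNReal.ofReal_ne_top) unitBallVolume_ne_top
  have hθ0 : θ ≠ 0 := by simpa [hθ] using hθ'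
  filter_upwards [hU θ hθ0, hdev θ hθ0, self_mem_nhdsWithin] with r hr1 hr2 hr0
  have hr : 0 < r := hr0
  -- every ball of radius `κ r` inside `B(x, r)` contains a good point
  have hgood : ∀ c : Rn n, dist c x ≤ (1 - κ) * r →
      ∃ y, dist y c < κ * r ∧ y ∈ Metric.ball x r ∧ y ∈ U ∧ y ∉ deviationSet f x A ε := by
    intro c hc
    by_contra! hno
    have hcr : Metric.ball c (κ * r) ⊆ Metric.ball x r :=
      Metric.ball_subset_ball' (by linarith)
    have hsub : Metric.ball c (κ * r) ⊆
        (Uᶜ ∩ Metric.ball x r) ∪ (deviationSet f x A ε ∩ Metric.ball x r) := by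
      intro y hy
      by_cases hyU : y ∈ U
      · exact Or.inr ⟨hno y hy (hcr hy) hyU, hcr hy⟩
      · exact Or.inl ⟨hyU, hcr hy⟩
    have h1 := (measure_mono hsub).trans ((measure_union_le _ _).trans (add_le_add hr1 hr2))
    rw [volume_ball_eq _ (by positivity), ENNReal.ofReal_mul hκ0.le, mul_pow] at h1
    have h2 : θ * ENNReal.ofReal r ^ n + θ * ENNReal.ofReal r ^ n =
        (ENNReal.ofReal κ ^ n * unitBallVolume n) / 2 * ENNReal.ofReal r ^ n := by
      rw [← add_mul, hθ, ← ENNReal.add_div, ← two_mul, mul_comm 2,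
        show (4 : ℝ≥0∞) = 2 * 2 by norm_num,
        ENNReal.mul_div_mul_right _ _ two_ne_zero ENNReal.ofNat_ne_top]
    have h3 : ENNReal.ofReal κ ^ n * ENNReal.ofReal r ^ n * unitBallVolume n =
        (ENNReal.ofReal κ ^ n * unitBallVolume n) * ENNReal.ofReal r ^ n := by ring
    rw [h2, h3, ENNReal.mul_le_mul_iff_left (pow_ne_zero _ (by simpa using hr))
      (ENNReal.pow_ne_top ENNReal.ofReal_ne_top)] at h1
    exact (ENNReal.half_lt_self hθ' hθ'').not_ge h1
  have hvr : ‖((1 - κ) * r) • v‖ ≤ (1 - κ) * r := by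
    rw [norm_smul, Real.norm_of_nonneg (mul_nonneg (by linarith) hr.le)]
    exact mul_le_of_le_one_right (mul_nonneg (by linarith) hr.le) hv1.le
  obtain ⟨y, hy1, hy2, hy3, hy4⟩ := hgood (x + ((1 - κ) * r) • v) (by simpa [dist_eq_norm] using hvr)
  obtain ⟨z, hz1, hz2, hz3, hz4⟩ := hgood (x - ((1 - κ) * r) • v) (by simpa [dist_eq_norm] using hvr)
  have hclose : ∀ w ∈ Metric.ball x r, w ∉ deviationSet f x A ε →
      ‖f w - f x - A (w - x)‖ ≤ ε * r := by
    intro w hw hwU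
    by_cases hwx : w = x
    · subst hwx
      simp only [sub_self, map_zero, norm_zero]
      positivity
    · simp only [deviationSet, mem_ofPred_eq, not_and, not_le] at hwU
      refine (hwU hwx).le.trans ?_
      gcongr
      exact (Metric.mem_ball.1 hw).le
  refine le_trans ?_ (Metric.edist_le_ediam_of_mem (mem_image_of_mem f ⟨hy2, hy3⟩)
    (mem_image_of_mem f ⟨hz2, hz3⟩))
  rw [edist_dist, ← ENNReal.ofReal_mul hpos.le, dist_eq_norm]
  refine ENNReal.ofReal_le_ofReal ?_
  have e1 := hclose y hy2 hy4
  have e2 := hclose z hz2 hz4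
  rw [dist_eq_norm] at hy1 hz1
  have e3 : ‖A (y - (x + ((1 - κ) * r) • v))‖ ≤ ε * r :=
    (A.le_opNorm _).trans (by rw [← hκA]; nlinarith)
  have e4 : ‖A (z - (x - ((1 - κ) * r) • v))‖ ≤ ε * r :=
    (A.le_opNorm _).trans (by rw [← hκA]; nlinarith)
  have e5 : ‖A ((2 * ((1 - κ) * r)) • v)‖ = 2 * ((1 - κ) * r) * ‖A v‖ := by
    rw [map_smul, norm_smul, Real.norm_of_nonneg]
    have : 0 < 1 - κ := by linarith
    positivity
  have e6 : A ((2 * ((1 - κ) * r)) • v) = (f y - f z) - (f y - f x - A (y - x)) +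
      (f z - f x - A (z - x)) - A (y - (x + ((1 - κ) * r) • v)) +
      A (z - (x - ((1 - κ) * r) • v)) := by
    simp only [map_sub, map_add, map_smul]
    module
  have e7 : ‖A ((2 * ((1 - κ) * r)) • v)‖ ≤ ‖f y - f z‖ + ε * r + ε * r + ε * r + ε * r := by
    rw [e6]
    exact norm_add_le_of_le (norm_sub_le_of_le (norm_add_le_of_le (norm_sub_le_of_le le_rfl e1) e2)
      e3) e4
  have e8 : 2 * ((1 - κ) * r) * (‖A‖ - ε) ≤ 2 * ((1 - κ) * r) * ‖A v‖ := by
    have : 0 < 1 - κ := by linarith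
    gcongr
  have e9 : 2 * ((1 - κ) * r) * (‖A‖ - ε) = 2 * r * ‖A‖ - 2 * r * ε - 2 * r * (κ * ‖A‖) +
      2 * r * (κ * ε) := by ring
  rw [hκA] at e9
  have e10 : 0 ≤ 2 * r * (κ * ε) := by positivity
  linarith

/-! ### Almost everywhere differentiation -/

theorem ae_restrict_of_forall_ball {n : ℕ} {Ω : Set (Rn n)} (hΩ : IsOpen Ω) {P : Rn n → Prop}
    (h : ∀ x R, 0 < R → Metric.closedBall x R ⊆ Ω → ∀ᵐ y, y ∈ Metric.ball x R → P y) :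
    ∀ᵐ y ∂(volume.restrict Ω), P y := by
  rw [ae_restrict_iff' hΩ.measurableSet, ae_iff]
  refine measure_null_of_locally_null _ fun x hx => ?_
  simp only [Classical.not_imp, mem_ofPred_eq] at hx
  obtain ⟨R, hR, hRΩ⟩ := Metric.nhds_basis_closedBall.mem_iff.1 (hΩ.mem_nhds hx.1)
  refine ⟨_, inter_mem_nhdsWithin _ (Metric.ball_mem_nhds x hR), measure_mono_null ?_
    (ae_iff.1 (h x R hR hRΩ))⟩
  rintro y ⟨hy, hyR⟩
  simp only [Classical.not_imp, mem_ofPred_eq] at hy ⊢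
  exact ⟨hyR, hy.2⟩

/-- Almost every point of `Ω` is a Lebesgue point of a locally integrable function on `Ω`. -/
theorem ae_tendsto_setLIntegral_ball {n : ℕ} {E : Type*} [NormedAddCommGroup E] {Ω : Set (Rn n)}
    (hΩ : IsOpen Ω) {G : Rn n → E} (hG : LocallyIntegrableOn G Ω) :
    ∀ᵐ x ∂(volume.restrict Ω), Tendsto
      (fun r : ℝ => (∫⁻ y in Metric.ball x r, ‖G y - G x‖ₑ) / ENNReal.ofReal r ^ n)
      (𝓝[>] 0) (𝓝 0) := by
  refine ae_restrict_of_forall_ball hΩ fun q R hR hRΩ => ?_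
  set S := Metric.closedBall q R
  have hSm : MeasurableSet S := Metric.isClosed_closedBall.measurableSet
  have hGi : LocallyIntegrable (S.indicator G) :=
    ((hG.integrableOn_compact_subset hRΩ (isCompact_closedBall q R)).integrable_indicator
      hSm).locallyIntegrable
  filter_upwards [(Besicovitch.vitaliFamily volume).ae_tendsto_lintegral_enorm_sub_div hGi]
    with x hx hxR
  have h1 := hx.comp (Besicovitch.tendsto_filterAt volume x)
  have h2 := ENNReal.Tendsto.const_mul (a := unitBallVolume n) h1
    (Or.inr unitBallVolume_ne_top)
  rw [mul_zero] at h2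
  refine tendsto_of_tendsto_of_tendsto_of_le_of_le' tendsto_const_nhds h2
    (.of_forall fun _ => zero_le) ?_
  obtain ⟨δ, hδ, hδR⟩ := Metric.isOpen_iff.1 Metric.isOpen_ball x hxR
  have hsmall : ∀ᶠ r : ℝ in 𝓝[>] 0, r < δ :=
    eventually_nhdsWithin_of_eventually_nhds (eventually_lt_nhds hδ)
  filter_upwards [hsmall, self_mem_nhdsWithin] with r hr hr0
  have hr' : 0 < r := hr0
  have hxS : x ∈ S := Metric.ball_subset_closedBall hxR
  have h3 : ∫⁻ y in Metric.ball x r, ‖G y - G x‖ₑ ≤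
      ∫⁻ y in Metric.closedBall x r, ‖S.indicator G y - S.indicator G x‖ₑ := by
    refine le_trans (setLIntegral_congr_fun Metric.isOpen_ball.measurableSet fun y hy => ?_).le
      (lintegral_mono_set Metric.ball_subset_closedBall)
    have : y ∈ S := Metric.ball_subset_closedBall (hδR (Metric.ball_subset_ball hr.le hy))
    simp only [indicator_of_mem this, indicator_of_mem hxS]
  have hcb : volume (Metric.closedBall x r) = ENNReal.ofReal r ^ n * unitBallVolume n := by
    rw [Measure.addHaar_closedBall _ _ hr'.le, finrank_euclideanSpace_fin, ENNReal.ofReal_pow hr'.le]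
    rfl
  simp only [Function.comp]
  rw [hcb, ← mul_div_assoc, mul_comm (ENNReal.ofReal r ^ n), ENNReal.mul_div_mul_left _ _
    unitBallVolume_ne_zero unitBallVolume_ne_top]
  gcongr

/-- If the density of `μ` at `x` exists along closed balls, then it exists along open balls, even
though `μ` may charge spheres: an open ball contains the slightly smaller closed balls. -/
theorem tendsto_ball_of_tendsto_closedBall {n : ℕ} {μ : Measure (Rn n)} {x : Rn n} {L : ℝ≥0∞}
    (h : Tendsto (fun r : ℝ => μ (Metric.closedBall x r) / volume (Metric.closedBall x r))
      (𝓝[>] 0) (𝓝 L)) :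
    Tendsto (fun r : ℝ => μ (Metric.ball x r) / volume (Metric.ball x r)) (𝓝[>] 0) (𝓝 L) := by
  have hcb : ∀ r : ℝ, 0 < r → volume (Metric.closedBall x r) = volume (Metric.ball x r) := by
    intro r hr
    rw [volume_ball_eq _ hr, Measure.addHaar_closedBall _ _ hr.le, finrank_euclideanSpace_fin,
      ENNReal.ofReal_pow hr.le]
    rfl
  -- for `t < 1` compare with the closed ball of radius `t r`
  have hlow : ∀ t : ℝ, 0 < t → t < 1 → ∀ r : ℝ, 0 < r → ENNReal.ofReal t ^ n *
      (μ (Metric.closedBall x (t * r)) / volume (Metric.closedBall x (t * r))) ≤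
        μ (Metric.ball x r) / volume (Metric.ball x r) := by
    intro t ht ht1 r hr
    have ht0 : ENNReal.ofReal t ^ n ≠ 0 := pow_ne_zero _ (by simpa using ht)
    rw [hcb _ (by positivity), volume_ball_eq _ (by positivity : 0 < t * r), volume_ball_eq _ hr,
      ENNReal.ofReal_mul ht.le, mul_pow, mul_assoc, ← mul_div_assoc,
      ENNReal.mul_div_mul_left _ _ ht0 (ENNReal.pow_ne_top ENNReal.ofReal_ne_top)]
    gcongr
    exact Metric.closedBall_subset_ball (by nlinarith)
  have hscale : ∀ t : ℝ, 0 < t → Tendsto (fun r : ℝ => t * r) (𝓝[>] 0) (𝓝[>] 0) := by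
    intro t ht
    refine tendsto_nhdsWithin_iff.2 ⟨?_, ?_⟩
    · have : Tendsto (fun r : ℝ => t * r) (𝓝 0) (𝓝 (t * 0)) := tendsto_id.const_mul t
      rw [mul_zero] at this
      exact this.mono_left nhdsWithin_le_nhds
    · filter_upwards [self_mem_nhdsWithin] with r hr
      exact mul_pos ht hr
  refine tendsto_of_le_liminf_of_limsup_le ?_ ?_
  · have h1 : ∀ t : ℝ, 0 < t → t < 1 → ENNReal.ofReal t ^ n * L ≤
        liminf (fun r : ℝ => μ (Metric.ball x r) / volume (Metric.ball x r)) (𝓝[>] 0) := by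
      intro t ht ht1
      have h2 := ENNReal.Tendsto.const_mul (a := ENNReal.ofReal t ^ n) (h.comp (hscale t ht))
        (Or.inr (ENNReal.pow_ne_top ENNReal.ofReal_ne_top))
      rw [← h2.liminf_eq]
      refine liminf_le_liminf ?_
      filter_upwards [self_mem_nhdsWithin] with r hr using hlow t ht ht1 r hr
    have h3 : Tendsto (fun t : ℝ => ENNReal.ofReal t ^ n * L) (𝓝[<] 1) (𝓝 (1 * L)) := by
      refine ENNReal.Tendsto.mul_const ?_ (Or.inl one_ne_zero)
      have : Tendsto (fun t : ℝ => ENNReal.ofReal t ^ n) (𝓝 1) (𝓝 (ENNReal.ofReal 1 ^ n)) :=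
        ((ENNReal.continuous_pow n).comp ENNReal.continuous_ofReal).tendsto 1
      rw [ENNReal.ofReal_one, one_pow] at this
      exact this.mono_left nhdsWithin_le_nhds
    rw [one_mul] at h3
    refine le_of_tendsto h3 ?_
    filter_upwards [Ioo_mem_nhdsLT (zero_lt_one' ℝ)] with t ht using h1 t ht.1 ht.2
  · rw [← h.limsup_eq]
    refine limsup_le_limsup ?_
    filter_upwards [self_mem_nhdsWithin] with r hr
    rw [hcb r hr]
    gcongr
    exact Metric.ball_subset_closedBall

/-- The volume of `f(E)` as a measure in `E`, for a homeomorphism `f` of `Ω` onto `Ω'`. -/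
theorem exists_pullback_volume {n : ℕ} {Ω Ω' : Set (Rn n)} (hΩ' : IsOpen Ω')
    {f : Rn n → Rn n} (hf : IsHomeoOn f Ω Ω') :
    ∃ μ : Measure (Rn n), ∀ E ⊆ Ω, MeasurableSet E → μ E = volume (f '' E) := by
  obtain ⟨e, he⟩ := hf
  have hcont : Continuous fun y : Ω' => (e.symm y : Rn n) :=
    continuous_subtype_val.comp e.symm.continuous
  refine ⟨Measure.map (fun y : Ω' => (e.symm y : Rn n))
    (Measure.comap (Subtype.val : Ω' → Rn n) volume), fun E hE hEm => ?_⟩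
  rw [Measure.map_apply hcont.measurable hEm,
    (MeasurableEmbedding.subtype_coe hΩ'.measurableSet).comap_apply]
  congr 1
  ext z
  constructor
  · rintro ⟨y, hy, rfl⟩
    refine ⟨e.symm y, hy, ?_⟩
    rw [← he, e.apply_symm_apply]
  · rintro ⟨w, hw, rfl⟩
    refine ⟨e ⟨w, hE hw⟩, ?_, he ⟨w, hE hw⟩⟩
    simpa using hw

theorem IsHomeoOn.continuousOn {n : ℕ} {Ω Ω' : Set (Rn n)} {f : Rn n → Rn n}
    (hf : IsHomeoOn f Ω Ω') : ContinuousOn f Ω := by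
  obtain ⟨e, he⟩ := hf
  rw [continuousOn_iff_continuous_domRestrict]
  have : Ω.domRestrict f = fun x => (e x : Rn n) := funext fun x => (he x).symm
  rw [this]
  exact continuous_subtype_val.comp e.continuous

theorem IsHomeoOn.volume_image_ball_ne_zero {n : ℕ} {Ω Ω' : Set (Rn n)} (hΩ' : IsOpen Ω')
    {f : Rn n → Rn n} (hf : IsHomeoOn f Ω Ω') {x : Rn n} {r : ℝ} (hr : 0 < r)
    (hsub : Metric.ball x r ⊆ Ω) : volume (f '' Metric.ball x r) ≠ 0 := by
  obtain ⟨e, he⟩ := hf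
  have hopen : IsOpen (f '' Metric.ball x r) := by
    have h1 : f '' Metric.ball x r = Subtype.val '' (e '' (Subtype.val ⁻¹' Metric.ball x r)) := by
      ext z
      constructor
      · rintro ⟨w, hw, rfl⟩
        exact ⟨e ⟨w, hsub hw⟩, mem_image_of_mem _ hw, he _⟩
      · rintro ⟨_, ⟨w, hw, rfl⟩, rfl⟩
        exact ⟨w, hw, (he w).symm⟩
    rw [h1]
    exact hΩ'.isOpenMap_subtype_val _
      (e.isOpenMap _ (Metric.isOpen_ball.preimage continuous_subtype_val))
  exact (hopen.measure_pos volume ⟨f x, mem_image_of_mem f (Metric.mem_ball_self hr)⟩).ne'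

/-- The volume derivative of a homeomorphism exists as a finite limit almost everywhere. -/
theorem IsHomeoOn.ae_tendsto_volume_ratio {n : ℕ} {Ω Ω' : Set (Rn n)} (hΩ : IsOpen Ω)
    (hΩ' : IsOpen Ω') {f : Rn n → Rn n} (hf : IsHomeoOn f Ω Ω') :
    ∀ᵐ x ∂(volume.restrict Ω), ∃ L : ℝ≥0∞, L ≠ ⊤ ∧ Tendsto
      (fun r : ℝ => volume (f '' Metric.ball x r) / volume (Metric.ball x r)) (𝓝[>] 0) (𝓝 L) := by
  obtain ⟨μ, hμ⟩ := exists_pullback_volume hΩ' hf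
  refine ae_restrict_of_forall_ball hΩ fun q R hR hRΩ => ?_
  set ν := μ.restrict (Metric.closedBall q R) with hν
  have hcompact : IsCompact (f '' Metric.closedBall q R) :=
    (isCompact_closedBall q R).image_of_continuousOn (hf.continuousOn.mono hRΩ)
  have : IsFiniteMeasure ν := ⟨by
    rw [hν, Measure.restrict_apply_univ, hμ _ hRΩ Metric.isClosed_closedBall.measurableSet]
    exact hcompact.measure_lt_top⟩
  filter_upwards [Besicovitch.ae_tendsto_rnDeriv ν volume, Measure.rnDeriv_lt_top ν volume]
    with x hx hxt hxR
  refine ⟨_, hxt.ne, (tendsto_ball_of_tendsto_closedBall hx).congr' ?_⟩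
  obtain ⟨δ, hδ, hδR⟩ := Metric.isOpen_iff.1 Metric.isOpen_ball x hxR
  have hsmall : ∀ᶠ r : ℝ in 𝓝[>] 0, r < δ :=
    eventually_nhdsWithin_of_eventually_nhds (eventually_lt_nhds hδ)
  filter_upwards [hsmall] with r hr
  have hsub : Metric.ball x r ⊆ Metric.closedBall q R :=
    ((Metric.ball_subset_ball hr.le).trans hδR).trans Metric.ball_subset_closedBall
  rw [hν, Measure.restrict_apply Metric.isOpen_ball.measurableSet, inter_eq_left.2 hsub,
    hμ _ (hsub.trans hRΩ) Metric.isOpen_ball.measurableSet]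

/-! ### Limits of the distortion quotients -/

/-- The common limit of the distortion quotients of a map that expands the ball `B(x, r)` to diameter `c r` and has
volume derivative `L`. -/
noncomputable def limitDistortion (n : ℕ) (c L : ℝ≥0∞) : ℝ≥0∞ :=
  (c ^ n / (unitBallVolume n * L)) ^ (1 / ((n : ℝ) - 1))

theorem tendsto_limitDistortion {n : ℕ} {c L : ℝ≥0∞} (hc : c ≠ ⊤) {ι : Type*} {l : Filter ι}
    {ρ : ι → ℝ≥0∞} (hρ : Tendsto ρ l (𝓝 L)) :
    Tendsto (fun i => limitDistortion n c (ρ i)) l (𝓝 (limitDistortion n c L)) :=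
  (ENNReal.continuous_rpow_const.tendsto _).comp
    (ENNReal.Tendsto.const_div
      (ENNReal.Tendsto.const_mul hρ (Or.inr unitBallVolume_ne_top)) (Or.inr (ENNReal.pow_ne_top hc)))

theorem tendsto_limitDistortion_left {n : ℕ} {c L : ℝ≥0∞} (hL : L ≠ 0) {ι : Type*}
    {l : Filter ι} {d : ι → ℝ≥0∞} (hd : Tendsto d l (𝓝 c)) :
    Tendsto (fun i => limitDistortion n (d i) L) l (𝓝 (limitDistortion n c L)) :=
  (ENNReal.continuous_rpow_const.tendsto _).comp
    (ENNReal.Tendsto.div_const (((ENNReal.continuous_pow n).tendsto c).comp hd)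
      (Or.inr (mul_ne_zero unitBallVolume_ne_zero hL)))

theorem limitDistortion_volume_ratio {n : ℕ} {c V : ℝ≥0∞} {x : Rn n} {r : ℝ} (hr : 0 < r) :
    limitDistortion n c (V / volume (Metric.ball x r)) =
      ((c * ENNReal.ofReal r) ^ n / V) ^ (1 / ((n : ℝ) - 1)) := by
  have hR0 : ENNReal.ofReal r ^ n ≠ 0 := pow_ne_zero _ (by simpa using hr)
  have hRt : ENNReal.ofReal r ^ n ≠ ⊤ := ENNReal.pow_ne_top ENNReal.ofReal_ne_top
  unfold limitDistortion
  rw [volume_ball_eq _ hr, ← mul_div_assoc, mul_comm (ENNReal.ofReal r ^ n),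
    ENNReal.mul_div_mul_left _ _ unitBallVolume_ne_zero unitBallVolume_ne_top, mul_pow,
    div_eq_mul_inv, ENNReal.inv_div (Or.inl hRt) (Or.inl hR0), mul_div_assoc]

section Limits

variable {n : ℕ} {f : Rn n → Rn n} {x : Rn n} {L : ℝ≥0∞}

theorem limsup_distortion_le (hn : 2 ≤ n)
    (hL : Tendsto (fun r : ℝ => volume (f '' Metric.ball x r) / volume (Metric.ball x r))
      (𝓝[>] 0) (𝓝 L))
    (hpos : ∀ᶠ r : ℝ in 𝓝[>] 0, volume (f '' Metric.ball x r) ≠ 0) {U : Set (Rn n)} {c : ℝ≥0∞}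
    (hc : c ≠ ⊤) (hU : ∀ᶠ r : ℝ in 𝓝[>] 0,
      Metric.ediam (f '' (Metric.ball x r ∩ U)) ≤ c * ENNReal.ofReal r) :
    limsup (fun r : ℝ => distortion f U x r) (𝓝[>] 0) ≤ limitDistortion n c L := by
  rw [← (tendsto_limitDistortion hc hL).limsup_eq]
  refine limsup_le_limsup ?_
  have hq : (0 : ℝ) ≤ 1 / ((n : ℝ) - 1) := by
    have : (2 : ℝ) ≤ n := by exact_mod_cast hn
    exact one_div_nonneg.2 (by linarith)
  filter_upwards [hpos, hU, self_mem_nhdsWithin] with r hr hrU hr0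
  rw [limitDistortion_volume_ratio hr0, distortion, if_neg hr]
  gcongr

theorem le_limsup_distortion (hn : 2 ≤ n)
    (hL : Tendsto (fun r : ℝ => volume (f '' Metric.ball x r) / volume (Metric.ball x r))
      (𝓝[>] 0) (𝓝 L)) {U : Set (Rn n)} {c : ℝ≥0∞}
    (hc : c ≠ ⊤) (hU : ∀ᶠ r : ℝ in 𝓝[>] 0,
      c * ENNReal.ofReal r ≤ Metric.ediam (f '' (Metric.ball x r ∩ U))) :
    limitDistortion n c L ≤ limsup (fun r : ℝ => distortion f U x r) (𝓝[>] 0) := by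
  rw [← (tendsto_limitDistortion hc hL).limsup_eq]
  refine limsup_le_limsup ?_
  have hq : (0 : ℝ) ≤ 1 / ((n : ℝ) - 1) := by
    have : (2 : ℝ) ≤ n := by exact_mod_cast hn
    exact one_div_nonneg.2 (by linarith)
  filter_upwards [hU, self_mem_nhdsWithin] with r hrU hr0
  rw [limitDistortion_volume_ratio hr0, distortion]
  split_ifs with h
  · exact le_top
  · gcongr

theorem tendsto_ofReal_two_mul (a b : ℝ) :
    Tendsto (fun ε : ℝ => ENNReal.ofReal (2 * a + b * ε)) (𝓝[>] 0) (𝓝 (ENNReal.ofReal (2 * a))) := by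
  have h : Continuous fun ε : ℝ => ENNReal.ofReal (2 * a + b * ε) :=
    ENNReal.continuous_ofReal.comp (by fun_prop)
  have h1 := h.tendsto 0
  simp only [mul_zero, add_zero] at h1
  exact h1.mono_left nhdsWithin_le_nhds

/-- A quantity bounded by the distortion of slightly larger linearisations is bounded by the
distortion of the linearisation itself, if the volume derivative does not vanish. -/
theorem le_limitDistortion_of_forall {a : ℝ} {b : ℝ≥0∞} (hL0 : L ≠ 0)
    (h : ∀ ε : ℝ, 0 < ε → b ≤ limitDistortion n (ENNReal.ofReal (2 * (a + ε))) L) :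
    b ≤ limitDistortion n (ENNReal.ofReal (2 * a)) L := by
  refine ge_of_tendsto (tendsto_limitDistortion_left hL0 (tendsto_ofReal_two_mul a 2)) ?_
  filter_upwards [self_mem_nhdsWithin] with ε hε
  rw [← mul_add]
  exact h ε hε

theorem limitDistortion_le_kFine_of_pos (hn : 2 ≤ n)
    (hL : Tendsto (fun r : ℝ => volume (f '' Metric.ball x r) / volume (Metric.ball x r))
      (𝓝[>] 0) (𝓝 L)) {A : Rn n →L[ℝ] Rn n} {ε : ℝ} (hε : 0 < ε)
    (hdev : HasDensityZeroAt (deviationSet f x A ε) x) :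
    limitDistortion n (ENNReal.ofReal (2 * ‖A‖ - 8 * ε)) L ≤ KFine f x :=
  le_iInf fun _ => le_iInf fun hU => le_iInf fun hxU =>
    le_limsup_distortion hn hL ENNReal.ofReal_ne_top
      (eventually_le_ediam_image hε ((hU x hxU).hasDensityZeroAt hn) hdev)

theorem limitDistortion_le_kFine (hn : 2 ≤ n)
    (hL : Tendsto (fun r : ℝ => volume (f '' Metric.ball x r) / volume (Metric.ball x r))
      (𝓝[>] 0) (𝓝 L)) {A : Rn n →L[ℝ] Rn n} (hL0 : L ≠ 0)
    (hdev : ∀ ε : ℝ, 0 < ε → HasDensityZeroAt (deviationSet f x A ε) x) :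
    limitDistortion n (ENNReal.ofReal (2 * ‖A‖)) L ≤ KFine f x := by
  refine le_of_tendsto (tendsto_limitDistortion_left hL0 (tendsto_ofReal_two_mul ‖A‖ (-8))) ?_
  filter_upwards [self_mem_nhdsWithin] with ε hε
  rw [neg_mul, ← sub_eq_add_neg]
  exact limitDistortion_le_kFine_of_pos hn hL hε (hdev ε hε)

/-- Where the volume derivative vanishes and the linearisation does not, every fine distortion is
infinite. -/
theorem kFine_eq_top (hn : 2 ≤ n)
    (hL : Tendsto (fun r : ℝ => volume (f '' Metric.ball x r) / volume (Metric.ball x r))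
      (𝓝[>] 0) (𝓝 0)) {A : Rn n →L[ℝ] Rn n} (hA : A ≠ 0)
    (hdev : ∀ ε : ℝ, 0 < ε → HasDensityZeroAt (deviationSet f x A ε) x) : KFine f x = ⊤ := by
  have hA0 : 0 < ‖A‖ := norm_pos_iff.2 hA
  have h1 := limitDistortion_le_kFine_of_pos hn hL (ε := ‖A‖ / 8) (by positivity)
    (hdev _ (by positivity))
  have hq : (0 : ℝ) < 1 / ((n : ℝ) - 1) := by
    have : (2 : ℝ) ≤ n := by exact_mod_cast hn
    exact one_div_pos.2 (by linarith)
  have h2 : limitDistortion n (ENNReal.ofReal (2 * ‖A‖ - 8 * (‖A‖ / 8))) 0 = ⊤ := by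
    have h3 : ENNReal.ofReal (2 * ‖A‖ - 8 * (‖A‖ / 8)) ^ n ≠ 0 :=
      pow_ne_zero _ (by simp only [ne_eq, ENNReal.ofReal_eq_zero, not_le]; linarith)
    rw [limitDistortion, mul_zero, ENNReal.div_zero h3, ENNReal.top_rpow_of_pos hq]
  rw [h2] at h1
  exact top_le_iff.1 h1

theorem kFine_le_k : KFine f x ≤ K f x := by
  refine iInf_le_of_le univ (iInf_le_of_le (fun y _ => ?_) (iInf_le_of_le (mem_univ x) le_rfl))
  simp [IsThinAt, capOne_empty]

theorem limitDistortion_pow_mul (hn : 2 ≤ n) {c : ℝ≥0∞} (hL0 : L ≠ 0) (hLt : L ≠ ⊤) :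
    limitDistortion n c L ^ (n - 1) * L = c ^ n / unitBallVolume n := by
  have hn1 : ((n - 1 : ℕ) : ℝ) = (n : ℝ) - 1 := by
    rw [Nat.cast_sub (by omega), Nat.cast_one]
  have hn0 : ((n - 1 : ℕ) : ℝ) ≠ 0 := by exact_mod_cast (by omega : n - 1 ≠ 0)
  rw [limitDistortion, ← hn1, ← ENNReal.rpow_natCast, ← ENNReal.rpow_mul, one_div_mul_cancel hn0,
    ENNReal.rpow_one, mul_comm _ L, ← mul_div_assoc, mul_comm (unitBallVolume n),
    ENNReal.mul_div_mul_left _ _ hL0 hLt]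

end Limits

theorem deviationSet_inter_ball_eq_empty {n : ℕ} {f : Rn n → Rn n} {x : Rn n}
    {A : Rn n →L[ℝ] Rn n} (hA : HasFDerivAt f A x) {ε : ℝ} (hε : 0 < ε) :
    ∀ᶠ r : ℝ in 𝓝[>] 0, deviationSet f x A ε ∩ Metric.ball x r = ∅ := by
  obtain ⟨δ, hδ, hsub⟩ := Metric.eventually_nhds_iff.1 (hA.isLittleO.def (half_pos hε))
  have hsmall : ∀ᶠ r : ℝ in 𝓝[>] 0, r < δ :=
    eventually_nhdsWithin_of_eventually_nhds (eventually_lt_nhds hδ)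
  filter_upwards [hsmall] with r hr
  refine eq_empty_of_forall_notMem fun y hy => ?_
  have h1 := hsub ((Metric.mem_ball.1 hy.2).trans hr)
  have h2 := hy.1.2
  have h3 : 0 < dist y x := dist_pos.2 hy.1.1
  rw [← dist_eq_norm y x] at h1
  nlinarith

/-- The fine distortion at a point of fine differentiability with nonzero volume derivative. -/
theorem kFine_eq_limitDistortion {n : ℕ} (hn : 2 ≤ n) {f : Rn n → Rn n} {x : Rn n} {L : ℝ≥0∞}
    {R : ℝ} (hR : 0 < R) (hf : ContinuousOn f (Metric.ball x R))
    (hL : Tendsto (fun r : ℝ => volume (f '' Metric.ball x r) / volume (Metric.ball x r))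
      (𝓝[>] 0) (𝓝 L)) (hL0 : L ≠ 0)
    (hpos : ∀ᶠ r : ℝ in 𝓝[>] 0, volume (f '' Metric.ball x r) ≠ 0) {A : Rn n →L[ℝ] Rn n}
    (hthin : ∀ ε : ℝ, 0 < ε → IsThinAt (deviationSet f x A ε) x) :
    KFine f x = limitDistortion n (ENNReal.ofReal (2 * ‖A‖)) L := by
  refine le_antisymm (le_limitDistortion_of_forall hL0 fun ε hε => ?_)
    (limitDistortion_le_kFine hn hL hL0 fun ε hε => (hthin ε hε).hasDensityZeroAt hn)
  refine iInf_le_of_le _ (iInf_le_of_le (isFinelyOpen_ball_diff_deviationSet hR hf (hthin ε hε))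
    (iInf_le_of_le ⟨Metric.mem_ball_self hR, fun h => h.1 rfl⟩ ?_))
  exact limsup_distortion_le hn hL hpos ENNReal.ofReal_ne_top
    (.of_forall fun r => ediam_image_le hε.le fun y hy => hy.2)

/-- At a point of differentiability with nonzero volume derivative both distortions are determined
by the derivative. -/
theorem k_eq_kFine_of_hasFDerivAt {n : ℕ} (hn : 2 ≤ n) {f : Rn n → Rn n} {x : Rn n} {L : ℝ≥0∞}
    (hL : Tendsto (fun r : ℝ => volume (f '' Metric.ball x r) / volume (Metric.ball x r))
      (𝓝[>] 0) (𝓝 L)) (hL0 : L ≠ 0)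
    (hpos : ∀ᶠ r : ℝ in 𝓝[>] 0, volume (f '' Metric.ball x r) ≠ 0) {A : Rn n →L[ℝ] Rn n}
    (hA : HasFDerivAt f A x) : K f x = KFine f x := by
  refine le_antisymm (le_trans (le_limitDistortion_of_forall (a := ‖A‖) hL0 fun ε hε => ?_)
    (limitDistortion_le_kFine (A := A) hn hL hL0 fun ε hε θ _ => ?_)) kFine_le_k
  · refine limsup_distortion_le hn hL hpos ENNReal.ofReal_ne_top ?_
    filter_upwards [deviationSet_inter_ball_eq_empty hA hε] with r hr
    have h1 : Metric.ball x r ∩ univ = Metric.ball x r ∩ (deviationSet f x A ε)ᶜ := by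
      rw [inter_univ, eq_comm, inter_eq_left]
      exact fun y hy hyd => notMem_empty y (hr ▸ ⟨hyd, hy⟩)
    rw [h1]
    exact ediam_image_le hε.le (subset_refl _)
  · filter_upwards [deviationSet_inter_ball_eq_empty hA hε] with r hr
    rw [hr, measure_empty]
    exact zero_le

end FineQC

open FineQC in
theorem mainTheorem5 {n : ℕ} (hn : 2 ≤ n)
    (Ω Ω' : Set (FineQC.Rn n)) (hΩ : IsOpen Ω) (hΩ' : IsOpen Ω')
    (f : FineQC.Rn n → FineQC.Rn n)
    (hhomeo : FineQC.IsHomeoOn f Ω Ω') (hsob : FineQC.MemW11Loc Ω f) :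
    (∀ G : FineQC.Rn n → FineQC.Rn n →L[ℝ] FineQC.Rn n, FineQC.IsWeakGradient Ω f G →
      ∀ᵐ x ∂(volume.restrict Ω), FineQC.KFine f x < ⊤ →
        FineQC.KFine f x ^ (n - 1) * FineQC.jacobian f x =
          2 ^ n / FineQC.unitBallVolume n * ‖G x‖ₑ ^ n) ∧
    (∀ᵐ x ∂(volume.restrict Ω), DifferentiableAt ℝ f x → 0 < FineQC.jacobian f x →
      FineQC.jacobian f x < ⊤ → FineQC.K f x = FineQC.KFine f x) := by
  have hball : ∀ x ∈ Ω, ∃ R : ℝ, 0 < R ∧ Metric.ball x R ⊆ Ω := Metric.isOpen_iff.1 hΩ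
  have hpos : ∀ x ∈ Ω, ∀ᶠ r : ℝ in 𝓝[>] 0, volume (f '' Metric.ball x r) ≠ 0 := by
    intro x hx
    obtain ⟨R, hR, hRΩ⟩ := hball x hx
    have hsmall : ∀ᶠ r : ℝ in 𝓝[>] 0, r < R :=
      eventually_nhdsWithin_of_eventually_nhds (eventually_lt_nhds hR)
    filter_upwards [hsmall, self_mem_nhdsWithin] with r hr hr0
    exact hhomeo.volume_image_ball_ne_zero hΩ' hr0 ((Metric.ball_subset_ball hr.le).trans hRΩ)
  constructor
  · intro G hG
    filter_upwards [ae_restrict_mem hΩ.measurableSet, hhomeo.ae_tendsto_volume_ratio hΩ hΩ',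
      ae_tendsto_setLIntegral_ball hΩ hG.locallyIntegrableOn_grad] with x hx ⟨L, hLt, hL⟩ hleb hfin
    have hthin : ∀ ε : ℝ, 0 < ε → IsThinAt (deviationSet f x (G x) ε) x := fun ε hε =>
      isThinAt_deviationSet hn hΩ hG hhomeo.continuousOn hx hleb hε
    have hJ : jacobian f x = L := hL.limsup_eq
    rw [hJ]
    by_cases hL0 : L = 0
    · -- finiteness of the fine distortion forces the gradient to vanish
      subst hL0
      have hG0 : G x = 0 := by
        by_contra h
        exact hfin.ne (kFine_eq_top hn hL h fun ε hε => (hthin ε hε).hasDensityZeroAt hn)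
      rw [hG0, ← ofReal_norm, norm_zero, ENNReal.ofReal_zero, zero_pow (by omega), mul_zero, mul_zero]
    · obtain ⟨R, hR, hRΩ⟩ := hball x hx
      rw [kFine_eq_limitDistortion hn hR (hhomeo.continuousOn.mono hRΩ) hL hL0 (hpos x hx) hthin,
        limitDistortion_pow_mul hn hL0 hLt, ENNReal.ofReal_mul zero_le_two, ofReal_norm, mul_pow,
        ENNReal.ofReal_ofNat, ENNReal.mul_div_right_comm]
  · filter_upwards [ae_restrict_mem hΩ.measurableSet, hhomeo.ae_tendsto_volume_ratio hΩ hΩ']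
      with x hx ⟨L, _, hL⟩ hdiff hJ0 _
    have hJ : jacobian f x = L := hL.limsup_eq
    exact k_eq_kFine_of_hasFDerivAt hn hL (hJ ▸ hJ0.ne') (hpos x hx) hdiff.hasFDerivAt
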